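/- For a finite simple graph $G$ let $\rho(G)$ be the largest eigenvalue of its adjacency matrix. For a graph $F$, a graph is $F$-free if it contains no (not necessarily induced) subgraph isomorphic to $F$; let $\mathrm{spex}(n,F)$ be the maximum of $\rho(G)$ over all $F$-free graphs $G$ of order $n$, and let $\mathrm{SPEX}(n,F)$ be the family, up to isomorphism, of $F$-free graphs $G$ of order $n$ with $\rho(G)=\mathrm{spex}(n,F)$. For $n>k>0$ and $0\le p\le\lfloor (n-k)/2\rfloor$ let $S_{n,k}^{p}$ be the graph obtained from the join $K_k\nabla (n-k)K_1$ by adding $p$ independent edges inside $(n-k)K_1$. Let $\beta(F)$ be the minimum size of a set of vertices of $F$ that meets all edges of $F$. **Theorem.** For every $\ell\ge 4$ there is $N=N(\ell)$ such that for every $n\ge N$ and every tree $F$ of order $\ell$, with partite sets $A$ and $B$, $|A|\le|B|$, and $\delta:=\min\{d_F(x):x\in A\}$, the following hold. (i) If $\ell$ is even, then $\mathrm{SPEX}(n,F)=\{S_{n,(\ell-2)/2}^{0}\}$ if and only if $\beta(F)=\ell/2$. (ii) If $\ell$ is odd, then $\mathrm{SPEX}(n,F)=\{S_{n,(\ell-3)/2}^{1}\}$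 if and only if $\beta(F)=(\ell-1)/2$ and $\delta\ge 2$. -/

import Mathlib

namespace SpectralTuran

/-- The spectral radius `ρ(G)` of a finite graph: the largest eigenvalue of its (real symmetric)
adjacency matrix. -/
noncomputable def rho {W : Type*} [Fintype W] (G : SimpleGraph W) : ℝ := by
  classical
  exact sSup (spectrum ℝ (G.adjMatrix ℝ))

/-- `spex(n, F)`: the maximum spectral radius over all `F`-free graphs of order `n`.
(The set is finite, and nonempty whenever `F` has an edge, so the supremum is a maximum.) -/
noncomputable def spex (n : ℕ) {V : Type*} (F : SimpleGraph V) : ℝ :=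
  sSup {r : ℝ | ∃ G : SimpleGraph (Fin n), F.Free G ∧ r = rho G}

/-- `SPEX(n, F)`: the `F`-free graphs of order `n` whose spectral radius is `spex(n, F)`,
as labelled graphs on `Fin n`. -/
def SPEX (n : ℕ) {V : Type*} (F : SimpleGraph V) : Set (SimpleGraph (Fin n)) :=
  {G | F.Free G ∧ rho G = spex n F}

/-- The graph `S_{n,k}^p` on `{0, …, n-1}`: the vertices `0, …, k-1` are adjacent to all other
vertices, and among the remaining `n - k` vertices the only edges are the `p` independent edges
`{k + 2t, k + 2t + 1}`, `t < p`. (Meant for `0 < k < n` and `p ≤ (n - k) / 2`.) -/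
def S (n k p : ℕ) : SimpleGraph (Fin n) :=
  SimpleGraph.fromRel fun i j =>
    i.val < k ∨ ∃ t < p, i.val = k + 2 * t ∧ j.val = k + 2 * t + 1

/-- The isomorphism class of a graph `H` on `Fin n`, as a family of labelled graphs on `Fin n`.
A family of graphs of order `n`, considered up to isomorphism, is `{H}` iff it equals this. -/
def isoClass {n : ℕ} (H : SimpleGraph (Fin n)) : Set (SimpleGraph (Fin n)) :=
  {G | Nonempty (G ≃g H)}

/-- The minimum of the degrees `d_F(x)` over `x ∈ A` (for nonempty `A`). -/
noncomputable def minDegreeOn {V : Type*} [Fintype V] (F : SimpleGraph V) (A : Finset V) : ℕ := by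
  classical
  exact sInf {d : ℕ | ∃ x ∈ A, d = F.degree x}

end SpectralTuran

/-!
Let `G` be an extremal `F`-free graph, `x` its Perron eigenvector with maximal entry `1`, and
`k + 1` the size of the smaller partite set of the tree `F`. An `F`-free graph has linearly many
edges, so few vertices carry a non-negligible weight; counting walks of length two against
`ρ(G) ^ 2 ≥ k (n - k)` then shows that exactly `k` vertices have weight close to `1`, each adjacent
to almost everything. Rewiring a vertex that misses one of them to these `k` vertices would keep the
graph `F`-free and increase `ρ`, so the set `M` of these vertices is completely joined to the rest.

What remains is which edges can lie outside `M`. An edge completes `F` if the side of `F` placed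
in `M` has a leaf to spare; a path of length two does if it has a vertex of degree two to spare, and
two disjoint edges do if the other side has two leaves with distinct neighbours. So no edge, resp.
at most one edge, is left, and `G` is a subgraph of `S n k 0`, resp. `S n k 1`. In the odd case,
that `S n k 1` is itself `F`-free comes from the smaller partite set being the unique minimum
vertex cover of `F` when all its degrees are at least two.
-/

namespace SpectralTuran

open Finset
open scoped Matrix
open SimpleGraph (Copy)

section Spectral

variable {W : Type*}

lemma isHermitian_adjMatrix (G : SimpleGraph W) [DecidableRel G.Adj] :
    (G.adjMatrix ℝ).IsHermitian :=
  G.isSymm_adjMatrix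

variable [Fintype W] {G H : SimpleGraph W}

lemma rho_eq_sSup_spectrum [DecidableEq W] (G : SimpleGraph W) [DecidableRel G.Adj] :
    rho G = sSup (spectrum ℝ (G.adjMatrix ℝ)) := by
  unfold rho
  congr!

lemma finite_spectrum_adjMatrix [DecidableEq W] (G : SimpleGraph W) [DecidableRel G.Adj] :
    (spectrum ℝ (G.adjMatrix ℝ)).Finite := by
  rw [(isHermitian_adjMatrix G).spectrum_real_eq_range_eigenvalues]
  exact Set.finite_range _

open scoped MatrixOrder in
lemma posSemidef_rho_sub_adjMatrix [DecidableEq W] (G : SimpleGraph W) [DecidableRel G.Adj] :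
    (algebraMap ℝ (Matrix W W ℝ) (rho G) - G.adjMatrix ℝ).PosSemidef := by
  have hA : IsSelfAdjoint (G.adjMatrix ℝ) := isHermitian_adjMatrix G
  refine Matrix.le_iff.mp (le_algebraMap_of_spectrum_le fun r hr => ?_)
  rw [rho_eq_sSup_spectrum]
  exact le_csSup (finite_spectrum_adjMatrix G).bddAbove hr

lemma rho_sub_adjMatrix_mulVec [DecidableEq W] (G : SimpleGraph W) [DecidableRel G.Adj]
    (x : W → ℝ) :
    (algebraMap ℝ (Matrix W W ℝ) (rho G) - G.adjMatrix ℝ) *ᵥ x =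
      rho G • x - G.adjMatrix ℝ *ᵥ x := by
  rw [Matrix.sub_mulVec, Algebra.algebraMap_eq_smul_one, Matrix.smul_mulVec, Matrix.one_mulVec]

lemma dotProduct_adjMatrix_mulVec_le (G : SimpleGraph W) [DecidableRel G.Adj] (x : W → ℝ) :
    x ⬝ᵥ G.adjMatrix ℝ *ᵥ x ≤ rho G * (x ⬝ᵥ x) := by
  classical
  have h := (posSemidef_rho_sub_adjMatrix G).dotProduct_mulVec_nonneg x
  rwa [rho_sub_adjMatrix_mulVec, star_trivial, dotProduct_sub, dotProduct_smul, smul_eq_mul,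
    sub_nonneg] at h

lemma adjMatrix_mulVec_eq_of_rho_mul_le [DecidableRel G.Adj] {x : W → ℝ}
    (h : rho G * (x ⬝ᵥ x) ≤ x ⬝ᵥ G.adjMatrix ℝ *ᵥ x) : G.adjMatrix ℝ *ᵥ x = rho G • x := by
  classical
  have h0 := (posSemidef_rho_sub_adjMatrix G).dotProduct_mulVec_zero_iff x
  rw [rho_sub_adjMatrix_mulVec, star_trivial, dotProduct_sub, dotProduct_smul, smul_eq_mul,
    sub_eq_zero, sub_eq_zero] at h0
  exact (h0.mp (h.antisymm (dotProduct_adjMatrix_mulVec_le G x))).symm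

lemma exists_mulVec_eq_rho_smul [Nonempty W] (G : SimpleGraph W) [DecidableRel G.Adj] :
    ∃ x : W → ℝ, x ≠ 0 ∧ G.adjMatrix ℝ *ᵥ x = rho G • x := by
  classical
  have hG := isHermitian_adjMatrix G
  have hmem : rho G ∈ spectrum ℝ (G.adjMatrix ℝ) := by
    rw [rho_eq_sSup_spectrum]
    refine Set.Nonempty.csSup_mem ?_ (finite_spectrum_adjMatrix G)
    rw [hG.spectrum_real_eq_range_eigenvalues]
    exact Set.range_nonempty _
  rw [hG.spectrum_real_eq_range_eigenvalues] at hmem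
  obtain ⟨i, hi⟩ := hmem
  refine ⟨hG.eigenvectorBasis i, fun h => ?_, hi ▸ hG.mulVec_eigenvectorBasis i⟩
  exact hG.eigenvectorBasis.orthonormal.ne_zero i (by ext v; exact congrFun h v)

/-- A nonnegative eigenvector for the spectral radius, normalised to have maximum entry `1`. -/
structure IsPerronVector (G : SimpleGraph W) [DecidableRel G.Adj] (x : W → ℝ) : Prop where
  nonneg (v : W) : 0 ≤ x v
  le_one (v : W) : x v ≤ 1
  exists_eq_one : ∃ v, x v = 1
  mulVec_eq : G.adjMatrix ℝ *ᵥ x = rho G • x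

namespace IsPerronVector

variable [DecidableRel G.Adj] {x : W → ℝ}

lemma sum_neighborFinset (hx : IsPerronVector G x) (v : W) :
    ∑ u ∈ G.neighborFinset v, x u = rho G * x v := by
  rw [← G.adjMatrix_mulVec_apply, hx.mulVec_eq, Pi.smul_apply, smul_eq_mul]

lemma rho_nonneg (hx : IsPerronVector G x) : 0 ≤ rho G := by
  obtain ⟨m, hm⟩ := hx.exists_eq_one
  rw [← mul_one (rho G), ← hm, ← hx.sum_neighborFinset]
  exact sum_nonneg fun u _ => hx.nonneg u

lemma dotProduct_mulVec (hx : IsPerronVector G x) :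
    x ⬝ᵥ G.adjMatrix ℝ *ᵥ x = rho G * (x ⬝ᵥ x) := by
  rw [hx.mulVec_eq, dotProduct_smul, smul_eq_mul]

lemma dotProduct_self_pos (hx : IsPerronVector G x) : 0 < x ⬝ᵥ x := by
  obtain ⟨m, hm⟩ := hx.exists_eq_one
  refine sum_pos' (fun v _ => mul_self_nonneg (x v)) ⟨m, mem_univ m, ?_⟩
  rw [hm]
  norm_num

end IsPerronVector

/-- Taking absolute values can only increase the quadratic form of the adjacency matrix. -/
lemma exists_isPerronVector [Nonempty W] (G : SimpleGraph W) [DecidableRel G.Adj] :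
    ∃ x : W → ℝ, IsPerronVector G x := by
  obtain ⟨y, hy0, hy⟩ := exists_mulVec_eq_rho_smul G
  have hyabs : G.adjMatrix ℝ *ᵥ |y| = rho G • |y| := by
    refine adjMatrix_mulVec_eq_of_rho_mul_le ?_
    calc rho G * (|y| ⬝ᵥ |y|) = y ⬝ᵥ G.adjMatrix ℝ *ᵥ y := by
          rw [hy, dotProduct_smul, smul_eq_mul]
          simp only [dotProduct, Pi.abs_apply, abs_mul_abs_self]
      _ ≤ |y| ⬝ᵥ G.adjMatrix ℝ *ᵥ |y| := by
          refine sum_le_sum fun v _ => (le_abs_self _).trans ?_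
          rw [abs_mul, G.adjMatrix_mulVec_apply, G.adjMatrix_mulVec_apply]
          exact mul_le_mul_of_nonneg_left (abs_sum_le_sum_abs _ _) (abs_nonneg _)
  obtain ⟨m, hm⟩ := Finite.exists_max |y|
  have hmpos : 0 < |y m| := by
    obtain ⟨v, hv⟩ := Function.ne_iff.mp hy0
    exact (abs_pos.mpr hv).trans_le (hm v)
  exact ⟨|y m|⁻¹ • |y|, fun v => mul_nonneg (inv_nonneg.mpr hmpos.le) (abs_nonneg _),
    fun v => (inv_mul_le_one₀ hmpos).mpr (hm v), ⟨m, inv_mul_cancel₀ hmpos.ne'⟩,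
    by rw [Matrix.mulVec_smul, hyabs, smul_comm]⟩

lemma pos_of_mulVec_eq_smul (hH : H.Connected) [DecidableRel H.Adj] {x : W → ℝ} {r : ℝ}
    (hx : ∀ v, 0 ≤ x v) (hx0 : x ≠ 0) (hHx : H.adjMatrix ℝ *ᵥ x = r • x) (v : W) : 0 < x v := by
  have eq_zero_of_adj {v u : W} (hvu : H.Adj v u) (hv : x v = 0) : x u = 0 := by
    have hsum : ∑ u ∈ H.neighborFinset v, x u = 0 := by
      rw [← H.adjMatrix_mulVec_apply, hHx, Pi.smul_apply, hv, smul_zero]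
    rw [sum_eq_zero_iff_of_nonneg fun u _ => hx u] at hsum
    exact hsum u ((H.mem_neighborFinset v u).mpr hvu)
  refine (hx v).lt_of_ne' fun hv => hx0 (funext fun u => ?_)
  obtain ⟨p⟩ := hH.preconnected v u
  induction p with
  | nil => exact hv
  | cons h _ ih => exact ih (eq_zero_of_adj h hv)

lemma rho_lt_rho_of_lt (hH : H.Connected) (hGH : G < H) : rho G < rho H := by
  classical
  have := hH.nonempty
  obtain ⟨x, hx⟩ := exists_isPerronVector G
  have hN (v : W) : G.neighborFinset v ⊆ H.neighborFinset v := fun u hu => by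
    rw [SimpleGraph.mem_neighborFinset] at hu ⊢
    exact hGH.le hu
  have hle (v : W) : (G.adjMatrix ℝ *ᵥ x) v ≤ (H.adjMatrix ℝ *ᵥ x) v := by
    rw [G.adjMatrix_mulVec_apply, H.adjMatrix_mulVec_apply]
    exact sum_le_sum_of_subset_of_nonneg (hN v) fun u _ _ => hx.nonneg u
  by_contra! hrho
  have hHx : H.adjMatrix ℝ *ᵥ x = rho H • x := by
    refine adjMatrix_mulVec_eq_of_rho_mul_le ?_
    calc rho H * (x ⬝ᵥ x) ≤ rho G * (x ⬝ᵥ x) :=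
          mul_le_mul_of_nonneg_right hrho hx.dotProduct_self_pos.le
      _ = x ⬝ᵥ G.adjMatrix ℝ *ᵥ x := hx.dotProduct_mulVec.symm
      _ ≤ x ⬝ᵥ H.adjMatrix ℝ *ᵥ x :=
          sum_le_sum fun v _ => mul_le_mul_of_nonneg_left (hle v) (hx.nonneg v)
  have hx0 : x ≠ 0 := by
    rintro rfl
    simpa using hx.exists_eq_one
  have hpos := pos_of_mulVec_eq_smul hH hx.nonneg hx0 hHx
  obtain ⟨v, u, hHvu, hGvu⟩ : ∃ v u, H.Adj v u ∧ ¬ G.Adj v u := by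
    by_contra! h
    exact hGH.not_ge fun v u => h v u
  have hlt : (G.adjMatrix ℝ *ᵥ x) v < (H.adjMatrix ℝ *ᵥ x) v := by
    rw [G.adjMatrix_mulVec_apply, H.adjMatrix_mulVec_apply]
    exact sum_lt_sum_of_subset (hN v) ((H.mem_neighborFinset v u).mpr hHvu)
      (mt (G.mem_neighborFinset v u).mp hGvu) (hpos u) fun u _ _ => hx.nonneg u
  rw [hx.mulVec_eq, hHx, Pi.smul_apply, Pi.smul_apply] at hlt
  exact hlt.not_ge (mul_le_mul_of_nonneg_right hrho (hx.nonneg v))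

lemma rho_congr {W' : Type*} [Fintype W'] {G' : SimpleGraph W'} (e : G ≃g G') :
    rho G = rho G' := by
  classical
  rw [rho_eq_sSup_spectrum, rho_eq_sSup_spectrum, ← SimpleGraph.Iso.reindex_adjMatrix ℝ e]
  exact congrArg sSup (AlgEquiv.spectrum_eq (Matrix.reindexAlgEquiv ℝ ℝ e.toEquiv) _).symm

lemma card_mul_le_adjMatrix_mulVec [DecidableRel G.Adj] {x : W → ℝ} (hx : ∀ v, 0 ≤ x v)
    {T : Finset W} {v : W} {c : ℝ} (hT : ∀ u ∈ T, G.Adj v u ∧ c ≤ x u) :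
    #T * c ≤ (G.adjMatrix ℝ *ᵥ x) v := by
  rw [G.adjMatrix_mulVec_apply, ← nsmul_eq_mul]
  refine (card_nsmul_le_sum T x c fun u hu => (hT u hu).2).trans ?_
  exact sum_le_sum_of_subset_of_nonneg
    (fun u hu => (G.mem_neighborFinset v u).mpr (hT u hu).1) fun u _ _ => hx u

lemma le_rho_of_le_adjMatrix_mulVec [DecidableRel G.Adj] {x : W → ℝ} {c : ℝ} {w : W}
    (hx : ∀ v, 0 ≤ x v) (hw : 0 < x w) (h : ∀ v, c * x v ≤ (G.adjMatrix ℝ *ᵥ x) v) :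
    c ≤ rho G := by
  have hpos : 0 < x ⬝ᵥ x :=
    sum_pos' (fun v _ => mul_self_nonneg (x v)) ⟨w, mem_univ w, mul_pos hw hw⟩
  refine le_of_mul_le_mul_right ?_ hpos
  calc c * (x ⬝ᵥ x) = x ⬝ᵥ c • x := by rw [dotProduct_smul, smul_eq_mul]
    _ ≤ x ⬝ᵥ G.adjMatrix ℝ *ᵥ x := sum_le_sum fun v _ => mul_le_mul_of_nonneg_left (h v) (hx v)
    _ ≤ rho G * (x ⬝ᵥ x) := dotProduct_adjMatrix_mulVec_le G x

lemma sqrt_card_mul_card_le_rho {L R : Finset W} (hL : L.Nonempty) (hR : R.Nonempty)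
    (hLR : G.IsCompleteBetween (L : Set W) R) : √(#L * #R : ℝ) ≤ rho G := by
  classical
  have hdisj : Disjoint L R := by exact_mod_cast hLR.disjoint
  set a : ℝ := √(#L : ℝ)
  set b : ℝ := √(#R : ℝ)
  have ha : a * a = #L := Real.mul_self_sqrt (by positivity)
  have hb : b * b = #R := Real.mul_self_sqrt (by positivity)
  have hb0 : 0 < b := Real.sqrt_pos.mpr (by exact_mod_cast hR.card_pos)
  -- The Perron vector of the complete bipartite graph between `L` and `R`.
  let x : W → ℝ := fun v => if v ∈ L then b else if v ∈ R then a else 0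
  have hxL {v : W} (hv : v ∈ L) : x v = b := if_pos hv
  have hxR {v : W} (hv : v ∈ R) : x v = a := by
    simp only [x, if_neg (disjoint_right.mp hdisj hv), if_pos hv]
  have hx0 (v : W) : 0 ≤ x v := by
    simp only [x]
    split_ifs <;> positivity
  obtain ⟨w, hw⟩ := hL
  rw [Real.sqrt_mul (by positivity)]
  refine le_rho_of_le_adjMatrix_mulVec hx0 (hxL hw ▸ hb0) fun v => ?_
  by_cases hvL : v ∈ L
  · calc a * b * x v = #R * a := by rw [hxL hvL, ← hb]; ring
      _ ≤ _ := card_mul_le_adjMatrix_mulVec hx0 fun u hu => ⟨hLR hvL hu, (hxR hu).ge⟩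
  by_cases hvR : v ∈ R
  · calc a * b * x v = #L * b := by rw [hxR hvR, ← ha]; ring
      _ ≤ _ := card_mul_le_adjMatrix_mulVec hx0 fun u hu => ⟨(hLR hu hvR).symm, (hxL hu).ge⟩
  · calc a * b * x v = 0 := by simp only [x, if_neg hvL, if_neg hvR, mul_zero]
      _ ≤ _ := by
        rw [G.adjMatrix_mulVec_apply]
        exact sum_nonneg fun u _ => hx0 u

end Spectral

section EdgeCount

variable {W : Type*} {G : SimpleGraph W}

lemma sum_card_adj_erase [DecidableEq W] [DecidableRel G.Adj] {U : Finset W} {a : W} (ha : a ∈ U) :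
    ∑ v ∈ U, #{u ∈ U | G.Adj v u} =
      2 * #{u ∈ U | G.Adj a u} + ∑ v ∈ U.erase a, #{u ∈ U.erase a | G.Adj v u} := by
  have herase (v : W) :
      #{u ∈ U | G.Adj v u} = #{u ∈ U.erase a | G.Adj v u} + if G.Adj v a then 1 else 0 := by
    conv_lhs => rw [← insert_erase ha, filter_insert]
    split_ifs with h
    · rw [card_insert_of_notMem fun h' => notMem_erase a U (mem_filter.mp h').1]
    · rfl
  have hdeg : ∑ v ∈ U.erase a, (if G.Adj v a then 1 else 0) = #{u ∈ U | G.Adj a u} := by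
    rw [← card_filter, herase a, if_neg (G.loopless.irrefl a), add_zero]
    simp only [G.adj_comm a]
  rw [← add_sum_erase U _ ha, sum_congr rfl fun v _ => herase v, sum_add_distrib, hdeg]
  ring

lemma sum_card_adj_comm [DecidableRel G.Adj] (X Y : Finset W) :
    ∑ y ∈ Y, #{x ∈ X | G.Adj y x} = ∑ x ∈ X, #{y ∈ Y | G.Adj x y} := by
  simpa only [bipartiteAbove, bipartiteBelow, G.adj_comm] using
    sum_card_bipartiteAbove_eq_sum_card_bipartiteBelow (s := Y) (t := X) G.Adj

end EdgeCount

section Embedding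

universe u

variable {V : Type u} {F : SimpleGraph V} {W : Type*} {G : SimpleGraph W}

lemma exists_copy_extending_to_leaf {a b : V} (hba : b ≠ a) (hb : ∀ u, F.Adj a u → u = b)
    (f : Copy (F.induce {a}ᶜ) G) {y : W} (hy : ∀ z, f z ≠ y) (hby : G.Adj (f ⟨b, hba⟩) y) :
    ∃ g : Copy F G, g a = y ∧ ∀ z : ({a}ᶜ : Set V), g z = f z := by
  let g : V → W := Function.extend Subtype.val f fun _ => y
  have hga : g a = y := Function.extend_apply' _ _ _ fun ⟨z, hz⟩ => z.2 hz
  have hg {z : V} (hz : z ≠ a) : g z = f ⟨z, hz⟩ :=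
    Subtype.val_injective.extend_apply f _ (⟨z, hz⟩ : ({a}ᶜ : Set V))
  have hadj_a {v : V} (hv : F.Adj a v) : G.Adj (g a) (g v) := by
    obtain rfl := hb v hv
    rw [hga, hg hba]
    exact hby.symm
  have hadj {u v : V} (huv : F.Adj u v) : G.Adj (g u) (g v) := by
    rcases eq_or_ne u a with rfl | hu
    · exact hadj_a huv
    rcases eq_or_ne v a with rfl | hv
    · exact (hadj_a huv.symm).symm
    rw [hg hu, hg hv]
    exact f.toHom.map_adj huv
  have hinj : Function.Injective g := by
    intro u v huv
    by_cases hu : u = a <;> by_cases hv : v = a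
    · rw [hu, hv]
    · rw [hu, hga, hg hv] at huv
      exact absurd huv.symm (hy _)
    · rw [hv, hga, hg hu] at huv
      exact absurd huv (hy _)
    · rw [hg hu, hg hv] at huv
      exact congrArg Subtype.val (f.injective huv)
  exact ⟨⟨⟨g, hadj⟩, hinj⟩, hga, fun z => hg z.2⟩

lemma card_filter_image_lt [DecidableEq W] {V : Type*} [Fintype V] [DecidableEq V]
    (S : V → Finset W) {a : V} {f : ({a}ᶜ : Set V) → W} (hf : ∀ z : ({a}ᶜ : Set V), f z ∈ S z)
    (ha : (S a).Nonempty) :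
    #{y ∈ univ.image f | y ∈ S a} < #{z | ¬ Disjoint (S z) (S a)} := by
  calc #{y ∈ univ.image f | y ∈ S a}
      ≤ #(univ.filter fun z : ({a}ᶜ : Set V) => f z ∈ S a) := by
        rw [filter_image]
        exact card_image_le
    _ ≤ #(({z | ¬ Disjoint (S z) (S a)} : Finset V).erase a) := by
        refine card_le_card_of_injOn Subtype.val (fun z hz => ?_) Subtype.val_injective.injOn
        rw [coe_filter] at hz
        rw [mem_coe, mem_erase, mem_filter]
        exact ⟨z.2, mem_univ _, not_disjoint_iff.mpr ⟨f z, hf z, hz.2⟩⟩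
    _ < #{z | ¬ Disjoint (S z) (S a)} := by
        refine card_erase_lt_of_mem (mem_filter.mpr ⟨mem_univ a, ?_⟩)
        rw [disjoint_self_iff_empty]
        exact ha.ne_empty

/-- Leaves are removed from `F` and put back one at a time; the leaf `v` can always be placed
because the target `S v` meets only few of the other target sets. -/
theorem exists_copy_forall_mem_of_isTree [DecidableEq W] [DecidableRel G.Adj] {V : Type u}
    [Fintype V] {F : SimpleGraph V} (hF : F.IsTree) (S : V → Finset W)
    (hne : ∀ v, (S v).Nonempty)
    (hS : ∀ u v, F.Adj u v → ∀ w ∈ S u, #{z | ¬ Disjoint (S z) (S v)} ≤ #{y ∈ S v | G.Adj w y}) :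
    ∃ f : Copy F G, ∀ v, f v ∈ S v := by
  classical
  induction hm : Fintype.card V generalizing V with
  | zero =>
    have := hF.1.nonempty
    exact absurd hm Fintype.card_ne_zero
  | succ m ih =>
    rcases subsingleton_or_nontrivial V with hsub | hnt
    · choose f hf using hne
      exact ⟨⟨⟨f, fun {u v} h => absurd (Subsingleton.elim u v) h.ne⟩,
        Function.injective_of_subsingleton f⟩, hf⟩
    obtain ⟨a, ha⟩ := hF.exists_vert_degree_one_of_nontrivial
    obtain ⟨b, hab, hb⟩ := SimpleGraph.degree_eq_one_iff_existsUnique_adj.mp ha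
    have hba : b ≠ a := hab.ne'
    obtain ⟨f, hf⟩ := ih (F := F.induce ({a}ᶜ : Set V))
      ⟨hF.1.induce_compl_singleton_of_degree_eq_one ha, hF.2.induce _⟩
      (fun z => S z) (fun z => hne z)
      (fun u v huv w hw => le_trans (card_le_card_of_injOn Subtype.val
        (fun z hz => by simpa using hz) Subtype.val_injective.injOn) (hS u v huv w hw))
      (by rw [Fintype.card_compl_set]; simp [hm])
    have hused : #{y ∈ univ.image f | y ∈ S a} < #{y ∈ S a | G.Adj (f ⟨b, hba⟩) y} :=
      (card_filter_image_lt S hf (hne a)).trans_le (hS b a hab.symm _ (hf _))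
    obtain ⟨y, hy, hyf⟩ := exists_mem_notMem_of_card_lt_card hused
    rw [mem_filter] at hy hyf
    obtain ⟨g, hga, hg⟩ := exists_copy_extending_to_leaf hba hb f (y := y)
      (fun z hz => hyf ⟨mem_image.mpr ⟨z, mem_univ z, hz⟩, hy.1⟩) hy.2
    refine ⟨g, fun z => ?_⟩
    rcases eq_or_ne z a with rfl | hz
    · rw [hga]
      exact hy.1
    · rw [hg ⟨z, hz⟩]
      exact hf ⟨z, hz⟩

variable [Fintype V] [DecidableRel G.Adj]

lemma exists_card_adj_lt (hF : F.IsTree) (hG : F.Free G) {U : Finset W} (hU : U.Nonempty) :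
    ∃ v ∈ U, #{u ∈ U | G.Adj v u} < Fintype.card V := by
  classical
  by_contra! hcon
  obtain ⟨f, -⟩ := exists_copy_forall_mem_of_isTree (G := G) hF (fun _ => U) (fun _ => hU)
    fun u v _ w hw => (card_le_univ _).trans (hcon w hw)
  exact hG ⟨f⟩

lemma exists_card_adj_lt_or (hF : F.IsTree) (hG : F.Free G) {A B : Finset V}
    (hAB : F.IsBipartiteWith (A : Set V) B) {X Y : Finset W} (hXY : Disjoint X Y)
    (hX : X.Nonempty) (hY : Y.Nonempty) :
    (∃ x ∈ X, #{y ∈ Y | G.Adj x y} < Fintype.card V) ∨ ∃ y ∈ Y, #{x ∈ X | G.Adj y x} < #A := by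
  classical
  by_contra! ⟨hXdeg, hYdeg⟩
  have hBA {v : V} (hv : v ∈ B) : v ∉ A := fun hvA => hAB.disjoint.notMem_of_mem_left hvA hv
  obtain ⟨f, -⟩ := exists_copy_forall_mem_of_isTree (G := G) hF (fun v => if v ∈ A then X else Y)
    (fun v => by split_ifs <;> assumption) fun u v huv w hw => by
      rcases hAB.mem_of_adj huv with ⟨hu, hv⟩ | ⟨hu, hv⟩
      · rw [if_pos (mem_coe.mp hu)] at hw
        rw [if_neg (hBA (mem_coe.mp hv))]
        exact (card_le_univ _).trans (hXdeg w hw)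
      · rw [if_neg (hBA (mem_coe.mp hu))] at hw
        rw [if_pos (mem_coe.mp hv)]
        refine (card_le_card fun z hz => ?_).trans (hYdeg w hw)
        by_contra hzA
        exact (mem_filter.mp hz).2 (by rw [if_neg hzA]; exact hXY.symm)
  exact hG ⟨f⟩

lemma sum_card_adj_le (hF : F.IsTree) (hG : F.Free G) (U : Finset W) :
    ∑ v ∈ U, #{u ∈ U | G.Adj v u} ≤ 2 * Fintype.card V * #U := by
  classical
  induction U using Finset.strongInduction with
  | H U ih =>
    rcases U.eq_empty_or_nonempty with rfl | hU
    · rw [sum_empty]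
      exact Nat.zero_le _
    obtain ⟨a, ha, hdeg⟩ := exists_card_adj_lt hF hG hU
    have hind := ih _ (erase_ssubset ha)
    have hcard := card_erase_add_one ha
    rw [sum_card_adj_erase ha]
    nlinarith

lemma sum_card_adj_le_of_disjoint (hF : F.IsTree) (hG : F.Free G) {A B : Finset V}
    (hAB : F.IsBipartiteWith (A : Set V) B) {k : ℕ} (hk : #A ≤ k + 1) {X Y : Finset W}
    (hXY : Disjoint X Y) :
    ∑ y ∈ Y, #{x ∈ X | G.Adj y x} ≤ k * #Y + Fintype.card V * #X := by
  classical
  induction hn : #X + #Y generalizing X Y with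
  | zero =>
    rw [card_eq_zero.mp (Nat.eq_zero_of_add_eq_zero_left hn), sum_empty]
    exact Nat.zero_le _
  | succ m ih =>
    rcases X.eq_empty_or_nonempty with rfl | hX
    · simp
    rcases Y.eq_empty_or_nonempty with rfl | hY
    · simp
    rcases exists_card_adj_lt_or hF hG hAB hXY hX hY with ⟨x, hx, hdeg⟩ | ⟨y, hy, hdeg⟩
    · have hcard := card_erase_add_one hx
      have hind := ih (disjoint_of_subset_left (erase_subset x X) hXY) (by omega)
      rw [sum_card_adj_comm] at hind ⊢
      rw [← add_sum_erase _ _ hx]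
      nlinarith
    · have hcard := card_erase_add_one hy
      have hind := ih (disjoint_of_subset_right (erase_subset y Y) hXY) (by omega)
      rw [← add_sum_erase _ _ hy]
      nlinarith

end Embedding

section HeavyVertices

variable {W : Type*} [Fintype W]

/-- The vertices of weight at least `η`. -/
noncomputable def heavyVertices (x : W → ℝ) (η : ℝ) : Finset W := {v | η ≤ x v}

lemma mem_heavyVertices {x : W → ℝ} {η : ℝ} {v : W} : v ∈ heavyVertices x η ↔ η ≤ x v := by
  rw [heavyVertices, mem_filter_univ]

variable {G : SimpleGraph W} [DecidableRel G.Adj] {x : W → ℝ} {η : ℝ}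

namespace IsPerronVector

lemma card_heavyVertices_mul_le (hx : IsPerronVector G x) :
    #(heavyVertices x η) * (rho G * η) ≤ ∑ v, (G.degree v : ℝ) := by
  calc #(heavyVertices x η) * (rho G * η) = ∑ _ ∈ heavyVertices x η, rho G * η := by
        rw [sum_const, nsmul_eq_mul]
    _ ≤ ∑ v ∈ heavyVertices x η, (G.degree v : ℝ) := by
        refine sum_le_sum fun v hv => ?_
        calc rho G * η ≤ rho G * x v :=
              mul_le_mul_of_nonneg_left (mem_heavyVertices.mp hv) hx.rho_nonneg
          _ = ∑ u ∈ G.neighborFinset v, x u := (hx.sum_neighborFinset v).symm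
          _ ≤ ∑ _ ∈ G.neighborFinset v, (1 : ℝ) := sum_le_sum fun u _ => hx.le_one u
          _ = G.degree v := by rw [sum_const, nsmul_one, G.card_neighborFinset_eq_degree]
    _ ≤ ∑ v, (G.degree v : ℝ) :=
        sum_le_sum_of_subset_of_nonneg (subset_univ _) fun _ _ _ => Nat.cast_nonneg _

lemma rho_mul_le_sum_heavyVertices (hx : IsPerronVector G x) (hη : 0 ≤ η) (u : W) :
    rho G * x u ≤ ∑ w ∈ heavyVertices x η with G.Adj u w, x w + η * G.degree u := by
  classical
  rw [← hx.sum_neighborFinset, ← sum_filter_add_sum_filter_not _ (· ∈ heavyVertices x η)]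
  refine add_le_add (le_of_eq (sum_congr ?_ fun _ _ => rfl)) ?_
  · ext w
    rw [mem_filter, mem_filter, G.mem_neighborFinset, and_comm]
  · calc ∑ w ∈ G.neighborFinset u with w ∉ heavyVertices x η, x w
        ≤ ∑ _ ∈ G.neighborFinset u with _ ∉ heavyVertices x η, η :=
          sum_le_sum fun w hw => (not_le.mp (mt mem_heavyVertices.mpr (mem_filter.mp hw).2)).le
      _ ≤ ∑ _ ∈ G.neighborFinset u, η :=
          sum_le_sum_of_subset_of_nonneg (filter_subset _ _) fun _ _ _ => hη
      _ = η * G.degree u := by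
          rw [sum_const, nsmul_eq_mul, G.card_neighborFinset_eq_degree, mul_comm]

end IsPerronVector

variable [DecidableEq W]

/-- The number of common neighbours of `v` and `w` outside `L`. -/
def codegreeOutside (G : SimpleGraph W) [DecidableRel G.Adj] (L : Finset W) (v w : W) : ℕ :=
  #{u ∈ G.neighborFinset v \ L | G.Adj w u}

lemma sum_sdiff_sum_filter_adj (x : W → ℝ) (L : Finset W) (v : W) :
    ∑ u ∈ G.neighborFinset v \ L, ∑ w ∈ L with G.Adj u w, x w =
      ∑ w ∈ L, codegreeOutside G L v w * x w := by
  simp only [sum_filter]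
  rw [sum_comm]
  refine sum_congr rfl fun w _ => ?_
  rw [← sum_filter, sum_const, nsmul_eq_mul, codegreeOutside]
  simp only [G.adj_comm w]

/-- Expand `ρ² x v` over the walks `v u w`: light `w` contribute the first term, heavy `u` and `w`
the second, and light `u` together with heavy `w` the third. -/
lemma IsPerronVector.rho_sq_mul_le (hx : IsPerronVector G x) (hη : 0 ≤ η) (v : W) :
    rho G ^ 2 * x v ≤ η * ∑ u, (G.degree u : ℝ) +
      ∑ u ∈ heavyVertices x η, (#{w ∈ heavyVertices x η | G.Adj u w} : ℝ) +
      ∑ w ∈ heavyVertices x η, codegreeOutside G (heavyVertices x η) v w * x w := by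
  set L := heavyVertices x η
  have hheavy : ∑ u ∈ G.neighborFinset v ∩ L, ∑ w ∈ L with G.Adj u w, x w ≤
      ∑ u ∈ L, (#{w ∈ L | G.Adj u w} : ℝ) := by
    calc ∑ u ∈ G.neighborFinset v ∩ L, ∑ w ∈ L with G.Adj u w, x w
        ≤ ∑ u ∈ G.neighborFinset v ∩ L, ∑ _ ∈ L with G.Adj u _, (1 : ℝ) :=
          sum_le_sum fun u _ => sum_le_sum fun w _ => hx.le_one w
      _ = ∑ u ∈ G.neighborFinset v ∩ L, (#{w ∈ L | G.Adj u w} : ℝ) := by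
          simp only [sum_const, nsmul_one]
      _ ≤ _ := sum_le_sum_of_subset_of_nonneg inter_subset_right fun _ _ _ => Nat.cast_nonneg _
  calc rho G ^ 2 * x v = ∑ u ∈ G.neighborFinset v, rho G * x u := by
        rw [← mul_sum, hx.sum_neighborFinset, sq, mul_assoc]
    _ ≤ ∑ u ∈ G.neighborFinset v, (∑ w ∈ L with G.Adj u w, x w + η * G.degree u) :=
        sum_le_sum fun u _ => hx.rho_mul_le_sum_heavyVertices hη u
    _ = η * ∑ u ∈ G.neighborFinset v, (G.degree u : ℝ) +
        (∑ u ∈ G.neighborFinset v ∩ L, ∑ w ∈ L with G.Adj u w, x w +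
          ∑ u ∈ G.neighborFinset v \ L, ∑ w ∈ L with G.Adj u w, x w) := by
        rw [sum_inter_add_sum_sdiff, sum_add_distrib, ← mul_sum, add_comm]
    _ ≤ η * ∑ u, (G.degree u : ℝ) + (∑ u ∈ L, (#{w ∈ L | G.Adj u w} : ℝ) +
        ∑ w ∈ L, codegreeOutside G L v w * x w) := by
        rw [sum_sdiff_sum_filter_adj]
        gcongr
        exact subset_univ _
    _ = _ := (add_assoc _ _ _).symm

end HeavyVertices

section Stability

variable {V : Type*} [Fintype V] {F : SimpleGraph V} {A B : Finset V}
  {W : Type*} [Fintype W] {G : SimpleGraph W} [DecidableRel G.Adj]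

lemma sum_degree_le (hF : F.IsTree) (hG : F.Free G) :
    ∑ v, (G.degree v : ℝ) ≤ 2 * Fintype.card V * Fintype.card W := by
  have h := sum_card_adj_le hF hG univ
  simp only [← G.neighborFinset_eq_filter, G.card_neighborFinset_eq_degree, card_univ] at h
  exact_mod_cast h

variable {x : W → ℝ} {η : ℝ} {k : ℕ}

lemma card_heavyVertices_le (hF : F.IsTree) (hG : F.Free G) (hx : IsPerronVector G x)
    (hη : 0 < η) (hρ : 2 * (Fintype.card V : ℝ) ≤ η ^ 2 * rho G) :
    #(heavyVertices x η) ≤ η * Fintype.card W := by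
  have := hF.1.nonempty
  have hρ0 : 0 < rho G := pos_of_mul_pos_right
    ((by positivity : (0 : ℝ) < 2 * Fintype.card V).trans_le hρ) (sq_nonneg η)
  refine le_of_mul_le_mul_right ?_ (mul_pos hρ0 hη)
  calc #(heavyVertices x η) * (rho G * η) ≤ 2 * Fintype.card V * Fintype.card W :=
        hx.card_heavyVertices_mul_le.trans (sum_degree_le hF hG)
    _ ≤ η ^ 2 * rho G * Fintype.card W := by gcongr
    _ = η * Fintype.card W * (rho G * η) := by ring

section

variable [DecidableEq W]

lemma sum_codegreeOutside_le (hF : F.IsTree) (hG : F.Free G)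
    (hAB : F.IsBipartiteWith (A : Set V) B) {k : ℕ} (hk : #A ≤ k + 1) (L : Finset W) (v : W) :
    ∑ w ∈ L, codegreeOutside G L v w ≤ k * G.degree v + Fintype.card V * #L := by
  have h := sum_card_adj_le_of_disjoint hF hG hAB hk (disjoint_sdiff (s := L)
    (t := G.neighborFinset v))
  rw [sum_card_adj_comm] at h
  refine h.trans (Nat.add_le_add_right (Nat.mul_le_mul_left k ?_) _)
  exact card_le_card sdiff_subset

lemma rho_sq_mul_le_add_sum_codegree (hF : F.IsTree) (hG : F.Free G) (hx : IsPerronVector G x)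
    (hη : 0 < η) (hρ : 2 * (Fintype.card V : ℝ) ≤ η ^ 2 * rho G) (v : W) :
    rho G ^ 2 * x v ≤ 4 * Fintype.card V * η * Fintype.card W +
      ∑ w ∈ heavyVertices x η, codegreeOutside G (heavyVertices x η) v w * x w := by
  have hLL : ∑ u ∈ heavyVertices x η, (#{w ∈ heavyVertices x η | G.Adj u w} : ℝ) ≤
      2 * Fintype.card V * (η * Fintype.card W) := by
    calc _ ≤ 2 * Fintype.card V * (#(heavyVertices x η) : ℝ) := by
          exact_mod_cast sum_card_adj_le hF hG (heavyVertices x η)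
      _ ≤ _ := by
          gcongr
          exact card_heavyVertices_le hF hG hx hη hρ
  have hdeg := mul_le_mul_of_nonneg_left (sum_degree_le hF hG) hη.le
  linarith [hx.rho_sq_mul_le hη.le v]

lemma sum_codegree_heavyVertices_le (hF : F.IsTree) (hG : F.Free G)
    (hAB : F.IsBipartiteWith (A : Set V) B) (hk : #A ≤ k + 1) (hx : IsPerronVector G x)
    (hη : 0 < η) (hρ : 2 * (Fintype.card V : ℝ) ≤ η ^ 2 * rho G) (v : W) :
    ∑ w ∈ heavyVertices x η, (codegreeOutside G (heavyVertices x η) v w : ℝ) ≤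
      k * G.degree v + Fintype.card V * η * Fintype.card W := by
  calc _ ≤ k * G.degree v + Fintype.card V * (#(heavyVertices x η) : ℝ) := by
        exact_mod_cast sum_codegreeOutside_le hF hG hAB hk (heavyVertices x η) v
    _ ≤ k * G.degree v + Fintype.card V * (η * Fintype.card W) := by
        gcongr
        exact card_heavyVertices_le hF hG hx hη hρ
    _ = _ := by ring

end

lemma card_mul_le_add_degree (hF : F.IsTree) (hG : F.Free G)
    (hAB : F.IsBipartiteWith (A : Set V) B) (hk1 : 1 ≤ k) (hk : #A ≤ k + 1)
    (hx : IsPerronVector G x) (hη : 0 < η) (hρ : 2 * (Fintype.card V : ℝ) ≤ η ^ 2 * rho G)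
    (hρ2 : (k - η) * Fintype.card W ≤ rho G ^ 2) (v : W) :
    Fintype.card W * x v ≤ 6 * Fintype.card V * η * Fintype.card W + G.degree v := by
  classical
  have := hF.1.nonempty
  have hl : (1 : ℝ) ≤ Fintype.card V := by exact_mod_cast Fintype.card_pos
  have hk1' : (1 : ℝ) ≤ k := by exact_mod_cast hk1
  set n : ℝ := (Fintype.card W : ℝ)
  set l : ℝ := (Fintype.card V : ℝ)
  have hsum : ∑ w ∈ heavyVertices x η, codegreeOutside G (heavyVertices x η) v w * x w ≤
      k * G.degree v + l * η * n :=
    (sum_le_sum fun w _ => mul_le_of_le_one_right (Nat.cast_nonneg _) (hx.le_one w)).trans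
      (sum_codegree_heavyVertices_le hF hG hAB hk hx hη hρ v)
  refine le_of_mul_le_mul_left ?_ (by linarith : (0 : ℝ) < k)
  calc k * (n * x v) = (k - η) * n * x v + η * n * x v := by ring
    _ ≤ rho G ^ 2 * x v + l * η * n := by
        refine add_le_add (mul_le_mul_of_nonneg_right hρ2 (hx.nonneg v)) ?_
        calc η * n * x v ≤ η * n := mul_le_of_le_one_right (by positivity) (hx.le_one v)
          _ ≤ l * (η * n) := le_mul_of_one_le_left (by positivity) hl
          _ = l * η * n := by ring
    _ ≤ 6 * l * η * n + k * G.degree v := by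
        linarith [rho_sq_mul_le_add_sum_codegree hF hG hx hη hρ v]
    _ ≤ k * (6 * l * η * n + G.degree v) := by
        rw [mul_add]
        exact add_le_add_left (le_mul_of_one_le_left (by positivity) hk1') _

end Stability

section Rewire

variable {W : Type*} {G : SimpleGraph W} {M : Finset W} {v : W}

/-- The graph obtained from `G` by replacing the neighbourhood of `v` by `M`. -/
def rewire (G : SimpleGraph W) (M : Finset W) (v : W) : SimpleGraph W :=
  SimpleGraph.fromRel fun a b => a ≠ v ∧ b ≠ v ∧ G.Adj a b ∨ a = v ∧ b ∈ M

lemma rewire_adj_of_ne {a b : W} (ha : a ≠ v) (hb : b ≠ v) :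
    (rewire G M v).Adj a b ↔ G.Adj a b := by
  have := @SimpleGraph.Adj.ne _ G a b
  grind [rewire, SimpleGraph.fromRel_adj, G.adj_comm]

lemma rewire_adj_left (hv : v ∉ M) {b : W} : (rewire G M v).Adj v b ↔ b ∈ M := by
  grind [rewire, SimpleGraph.fromRel_adj]

lemma adjMatrix_rewire [DecidableEq W] [DecidableRel G.Adj] [DecidableRel (rewire G M v).Adj]
    (hv : v ∉ M) {d : W → ℝ}
    (hd : ∀ u, d u = (if u ∈ M then 1 else 0) - if G.Adj v u then 1 else 0) :
    (rewire G M v).adjMatrix ℝ =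
      G.adjMatrix ℝ +
        (Matrix.vecMulVec (Pi.single v 1) d + Matrix.vecMulVec d (Pi.single v 1)) := by
  ext a b
  simp only [Matrix.add_apply, Matrix.vecMulVec_apply, SimpleGraph.adjMatrix_apply, hd,
    Pi.single_apply]
  by_cases ha : a = v
  · subst ha
    by_cases hb : b = a
    · simp [hb, hv]
    · simp [hb, rewire_adj_left hv]
  by_cases hb : b = v
  · subst hb
    simp [ha, SimpleGraph.adj_comm _ a b, rewire_adj_left hv]
  · simp [ha, hb, rewire_adj_of_ne ha hb]

variable [Fintype W] [DecidableRel G.Adj]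

/-- The common neighbours of the vertices in `T`. -/
def commonNeighborFinset (G : SimpleGraph W) [DecidableRel G.Adj] (T : Finset W) : Finset W :=
  {v | ∀ m ∈ T, G.Adj m v}

lemma mem_commonNeighborFinset {T : Finset W} :
    v ∈ commonNeighborFinset G T ↔ ∀ m ∈ T, G.Adj m v :=
  mem_filter_univ v

/-- In a copy of `F` in the rewired graph, `v` can be replaced by an unused common neighbour of
`M`. -/
lemma rewire_free {V : Type*} [Fintype V] {F : SimpleGraph V} (hG : F.Free G) (hv : v ∉ M)
    (hM : Fintype.card V < #(commonNeighborFinset G M)) : F.Free (rewire G M v) := by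
  classical
  rintro ⟨f⟩
  obtain ⟨w, hw, hwf⟩ := exists_mem_notMem_of_card_lt_card
    ((card_image_le (s := univ) (f := f)).trans_lt hM)
  have hfw (u : V) : f u ≠ w := fun h => hwf (h ▸ mem_image_of_mem f (mem_univ u))
  have hadj {u u' : V} (h : F.Adj u u') (hu : f u = v) :
      G.Adj (Equiv.swap v w (f u)) (Equiv.swap v w (f u')) := by
    have hne : f u' ≠ v := fun h' => h.ne (f.injective (hu.trans h'.symm))
    have hmem : f u' ∈ M := (rewire_adj_left hv).mp (hu ▸ f.toHom.map_adj h)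
    rw [hu, Equiv.swap_apply_left, Equiv.swap_apply_of_ne_of_ne hne (hfw u')]
    exact (mem_commonNeighborFinset.mp hw _ hmem).symm
  refine hG ⟨⟨Equiv.swap v w ∘ f, fun {u u'} h => ?_⟩, (Equiv.injective _).comp f.injective⟩
  by_cases hu : f u = v
  · exact hadj h hu
  by_cases hu' : f u' = v
  · exact (hadj h.symm hu').symm
  rw [Function.comp_apply, Function.comp_apply, Equiv.swap_apply_of_ne_of_ne hu (hfw u),
    Equiv.swap_apply_of_ne_of_ne hu' (hfw u')]
  exact (rewire_adj_of_ne hu hu').mp (f.toHom.map_adj h)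

lemma rho_lt_rho_rewire {x : W → ℝ} (hx : IsPerronVector G x) (hv : v ∉ M)
    (hlt : ∑ u ∈ G.neighborFinset v, x u < ∑ m ∈ M, x m) : rho G < rho (rewire G M v) := by
  classical
  let d : W → ℝ := fun u => (if u ∈ M then 1 else 0) - if G.Adj v u then 1 else 0
  have hdv : d v = 0 := by simp [d, hv]
  have hdx : d ⬝ᵥ x = ∑ m ∈ M, x m - ∑ u ∈ G.neighborFinset v, x u := by
    simp [d, dotProduct, sub_mul, sum_ite_mem, G.neighborFinset_eq_filter, sum_filter]
  have hdpos : 0 < d ⬝ᵥ x := hdx ▸ sub_pos.mpr hlt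
  have hmul : (rewire G M v).adjMatrix ℝ *ᵥ x =
      rho G • x + ((d ⬝ᵥ x) • Pi.single v 1 + x v • d) := by
    rw [adjMatrix_rewire (d := d) hv fun _ => rfl, Matrix.add_mulVec, Matrix.add_mulVec,
      hx.mulVec_eq]
    simp [Matrix.vecMulVec_mulVec]
  by_contra! hle
  have heig : (rewire G M v).adjMatrix ℝ *ᵥ x = rho (rewire G M v) • x := by
    refine adjMatrix_mulVec_eq_of_rho_mul_le ?_
    calc rho (rewire G M v) * (x ⬝ᵥ x) ≤ rho G * (x ⬝ᵥ x) :=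
          mul_le_mul_of_nonneg_right hle hx.dotProduct_self_pos.le
      _ ≤ rho G * (x ⬝ᵥ x) + ((d ⬝ᵥ x) * x v + x v * (d ⬝ᵥ x)) :=
          le_add_of_nonneg_right <| by
            have := hx.nonneg v
            positivity
      _ = x ⬝ᵥ (rewire G M v).adjMatrix ℝ *ᵥ x := by
          simp [hmul, dotProduct_comm x d]
  have hrho_v : rho (rewire G M v) * x v = rho G * x v + d ⬝ᵥ x := by
    simpa [hdv] using congrFun (heig.symm.trans hmul) v
  linarith [mul_le_mul_of_nonneg_right hle (hx.nonneg v)]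

end Rewire

section Structure

lemma le_card_heavyVertices {W : Type*} [Fintype W] {x c : W → ℝ} {L : Finset W} {n θ ε : ℝ}
    {k : ℕ} (hx : ∀ w, x w ≤ 1) (hn : 0 < n) (hθ : 0 < θ) (hεθ : ε * θ + 2 * ε < θ)
    (hc0 : ∀ w, 0 ≤ c w) (hcn : ∀ w, c w ≤ n) (hlow : (k - ε) * n ≤ ∑ w ∈ L, c w * x w)
    (hup : ∑ w ∈ L, c w ≤ (k + ε) * n) : k ≤ #(heavyVertices x (1 - θ)) := by
  classical
  set M := heavyVertices x (1 - θ)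
  have hpoint (w : W) : θ * (c w * x w) ≤ (if w ∈ M then θ * n else 0) + (c w - c w * x w) := by
    have hcx : c w * x w ≤ c w := mul_le_of_le_one_right (hc0 w) (hx w)
    split_ifs with hw
    · linarith [mul_le_mul_of_nonneg_left (hcx.trans (hcn w)) hθ.le]
    · have hxw : x w < 1 - θ := not_le.mp (mt mem_heavyVertices.mpr hw)
      linarith [mul_le_mul_of_nonneg_left hcx hθ.le,
        mul_le_mul_of_nonneg_left hxw.le (hc0 w)]
  have hsum : θ * ∑ w ∈ L, c w * x w ≤
      #M * (θ * n) + (∑ w ∈ L, c w - ∑ w ∈ L, c w * x w) := by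
    calc θ * ∑ w ∈ L, c w * x w
        ≤ ∑ w ∈ L, ((if w ∈ M then θ * n else 0) + (c w - c w * x w)) := by
          rw [mul_sum]
          exact sum_le_sum fun w _ => hpoint w
      _ = #(L ∩ M) * (θ * n) + (∑ w ∈ L, c w - ∑ w ∈ L, c w * x w) := by
          rw [sum_add_distrib, sum_sub_distrib, sum_ite_mem, sum_const, nsmul_eq_mul]
      _ ≤ _ := by
          gcongr
          exact inter_subset_right
  have hcard : θ * k * n < θ * (#M + 1) * n := by
    linarith [mul_le_mul_of_nonneg_left hlow hθ.le, mul_lt_mul_of_pos_right hεθ hn]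
  have : (k : ℝ) < #M + 1 := lt_of_mul_lt_mul_left (lt_of_mul_lt_mul_right hcard hn.le) hθ.le
  exact Nat.lt_succ_iff.mp (by exact_mod_cast this)

variable {V : Type*} [Fintype V] {F : SimpleGraph V} {A B : Finset V}
  {W : Type*} [Fintype W] {G : SimpleGraph W}

/-- `G` contains a spanning complete bipartite graph with a part of size `k`. -/
def HasCompleteSplit {W : Type*} (k : ℕ) (G : SimpleGraph W) : Prop :=
  ∃ M : Finset W, #M = k ∧ G.IsCompleteBetween (M : Set W) (M : Set W)ᶜ

section

variable [DecidableRel G.Adj]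

lemma card_commonNeighborFinset_lt (hF : F.IsTree) (hG : F.Free G)
    (hAB : F.IsBipartiteWith (A : Set V) B) {T : Finset W} (hT : T.Nonempty) (hAT : #A ≤ #T) :
    #(commonNeighborFinset G T) < Fintype.card V := by
  by_contra! hcard
  have := hF.1.nonempty
  have hadj {m v : W} (hm : m ∈ T) (hv : v ∈ commonNeighborFinset G T) : G.Adj m v :=
    mem_commonNeighborFinset.mp hv m hm
  have hdisj : Disjoint T (commonNeighborFinset G T) :=
    disjoint_left.mpr fun a ha ha' => (hadj ha ha').ne rfl
  rcases exists_card_adj_lt_or hF hG hAB hdisj hT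
    (card_pos.mp (Fintype.card_pos.trans_le hcard)) with ⟨m, hm, hlt⟩ | ⟨v, hv, hlt⟩
  · rw [filter_true_of_mem fun v hv => hadj hm hv] at hlt
    exact hlt.not_ge hcard
  · rw [filter_true_of_mem fun m hm => (hadj hm hv).symm] at hlt
    exact hlt.not_ge hAT

lemma card_adj_commonNeighborFinset_lt (hF : F.IsTree) (hG : F.Free G)
    (hAB : F.IsBipartiteWith (A : Set V) B) {M : Finset W} (hAM : #A ≤ #M + 1) {v : W}
    (hv : v ∉ M) : #{u ∈ commonNeighborFinset G M | G.Adj v u} < Fintype.card V := by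
  classical
  refine lt_of_le_of_lt (card_le_card fun u hu => ?_)
    (card_commonNeighborFinset_lt hF hG hAB (insert_nonempty v M)
      (by rwa [card_insert_of_notMem hv]))
  rw [mem_filter, mem_commonNeighborFinset] at hu
  exact mem_commonNeighborFinset.mpr ((forall_mem_insert _ _ _).mpr ⟨hu.2, hu.1⟩)

variable {M : Finset W} {x : W → ℝ} {δ : ℝ}

lemma card_compl_commonNeighborFinset_le [DecidableEq W] {T : Finset W}
    (hT : ∀ w ∈ T, (1 - δ) * Fintype.card W ≤ G.degree w) :
    (#(commonNeighborFinset G T)ᶜ : ℝ) ≤ #T * (δ * Fintype.card W) := by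
  have hsub : (commonNeighborFinset G T)ᶜ ⊆ T.biUnion fun w => (G.neighborFinset w)ᶜ := by
    intro v hv
    simpa [mem_commonNeighborFinset] using hv
  calc (#(commonNeighborFinset G T)ᶜ : ℝ) ≤ ∑ w ∈ T, (#(G.neighborFinset w)ᶜ : ℝ) := by
        exact_mod_cast (card_le_card hsub).trans card_biUnion_le
    _ ≤ #T • (δ * Fintype.card W) := by
        refine sum_le_card_nsmul _ _ _ fun w hw => ?_
        rw [card_compl, Nat.cast_sub (card_le_univ _), G.card_neighborFinset_eq_degree]
        linarith [hT w hw]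
    _ = #T * (δ * Fintype.card W) := nsmul_eq_mul _ _

lemma half_card_le_card_commonNeighborFinset {T : Finset W}
    (hT : ∀ w ∈ T, (1 - δ) * Fintype.card W ≤ G.degree w) (hTδ : #T * δ ≤ 1 / 2) :
    (Fintype.card W : ℝ) / 2 ≤ #(commonNeighborFinset G T) := by
  classical
  have hcompl := card_compl_commonNeighborFinset_le hT
  rw [card_compl, Nat.cast_sub (card_le_univ _)] at hcompl
  have := mul_le_mul_of_nonneg_right hTδ (Nat.cast_nonneg (α := ℝ) (Fintype.card W))
  linarith

lemma exists_card_neighborFinset_sdiff_le [DecidableEq W] (hF : F.IsTree) (hG : F.Free G)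
    (hAB : F.IsBipartiteWith (A : Set V) B) (hAM : #A ≤ #M + 1)
    (hM : ¬ G.IsCompleteBetween (M : Set W) (M : Set W)ᶜ) :
    ∃ v ∉ M, (∃ m ∈ M, ¬ G.Adj m v) ∧ #(G.neighborFinset v \ M) ≤ 2 * Fintype.card V := by
  let C := commonNeighborFinset G M
  have hne : (M ∪ C)ᶜ.Nonempty := by
    obtain ⟨m, hm, v, hv, hmv⟩ : ∃ m ∈ M, ∃ v ∉ M, ¬ G.Adj m v := by
      by_contra! h
      exact hM fun m hm v hv => h m hm v hv
    refine ⟨v, ?_⟩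
    rw [mem_compl, mem_union, mem_commonNeighborFinset]
    exact fun h => h.elim hv fun h => hmv (h m hm)
  obtain ⟨v, hv, hdeg⟩ := exists_card_adj_lt hF hG hne
  rw [mem_compl, mem_union, not_or, mem_commonNeighborFinset] at hv
  refine ⟨v, hv.1, by simpa using hv.2, ?_⟩
  have hsub : G.neighborFinset v \ M ⊆ {u ∈ C | G.Adj v u} ∪ {u ∈ (M ∪ C)ᶜ | G.Adj v u} := by
    intro u hu
    rw [mem_sdiff, G.mem_neighborFinset] at hu
    by_cases huC : u ∈ C <;> simp [huC, hu]
  have hadjC : #{u ∈ C | G.Adj v u} < Fintype.card V :=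
    card_adj_commonNeighborFinset_lt hF hG hAB hAM hv.1
  have := (card_le_card hsub).trans (card_union_le _ _)
  omega

lemma IsPerronVector.sum_neighborFinset_lt [DecidableEq W] (hx : IsPerronVector G x) {l : ℝ}
    (hl : 0 < l) (hheavy : ∀ m ∈ M, 1 / 2 ≤ x m) (hlight : ∀ u ∉ M, 8 * l * x u ≤ 1) {m v : W}
    (hm : m ∈ M) (hmv : ¬ G.Adj m v) (hcard : #(G.neighborFinset v \ M) ≤ 2 * l) :
    ∑ u ∈ G.neighborFinset v, x u < ∑ u ∈ M, x u := by
  have hinter : ∑ u ∈ G.neighborFinset v ∩ M, x u ≤ ∑ u ∈ M.erase m, x u := by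
    refine sum_le_sum_of_subset_of_nonneg (fun u hu => ?_) fun u _ _ => hx.nonneg u
    rw [mem_inter, G.mem_neighborFinset] at hu
    exact mem_erase.mpr ⟨fun h => hmv (h ▸ hu.1.symm), hu.2⟩
  have hsdiff : 8 * l * ∑ u ∈ G.neighborFinset v \ M, x u ≤ 2 * l := by
    rw [mul_sum]
    refine (sum_le_card_nsmul _ _ 1 fun u hu => hlight u (mem_sdiff.mp hu).2).trans ?_
    rwa [nsmul_one]
  have hquarter : ∑ u ∈ G.neighborFinset v \ M, x u ≤ 1 / 4 :=
    le_of_mul_le_mul_left (by linarith) (by positivity : 0 < 8 * l)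
  rw [← sum_inter_add_sum_sdiff _ M, ← add_sum_erase M x hm]
  linarith [hheavy m hm]

lemma isCompleteBetween_of_forall_rho_le (hF : F.IsTree) (hG : F.Free G)
    (hAB : F.IsBipartiteWith (A : Set V) B)
    (hmax : ∀ G' : SimpleGraph W, F.Free G' → rho G' ≤ rho G) (hx : IsPerronVector G x)
    (hAM : #A ≤ #M + 1)
    (hMcard : Fintype.card V < #(commonNeighborFinset G M)) (hheavy : ∀ m ∈ M, 1 / 2 ≤ x m)
    (hlight : ∀ v ∉ M, 8 * Fintype.card V * x v ≤ 1) :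
    G.IsCompleteBetween (M : Set W) (M : Set W)ᶜ := by
  classical
  have := hF.1.nonempty
  by_contra hcon
  obtain ⟨v, hv, ⟨m, hm, hmv⟩, hcard⟩ := exists_card_neighborFinset_sdiff_le hF hG hAB hAM hcon
  refine (hmax _ (rewire_free hG hv hMcard)).not_gt (rho_lt_rho_rewire hx hv ?_)
  exact hx.sum_neighborFinset_lt (by exact_mod_cast Fintype.card_pos) hheavy hlight hm hmv
    (by exact_mod_cast hcard)

lemma mul_le_one_of_notMem (hF : F.IsTree) (hG : F.Free G)
    (hAB : F.IsBipartiteWith (A : Set V) B) (hAM : #A ≤ #M + 1) (hMV : #M ≤ Fintype.card V)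
    (hδ0 : 0 ≤ δ) (hδ : 32 * (Fintype.card V : ℝ) ^ 2 * δ ≤ 1)
    (hn : 32 * (Fintype.card V : ℝ) ^ 2 ≤ Fintype.card W)
    (hM : ∀ w ∈ M, (1 - 2 * δ) * Fintype.card W ≤ G.degree w) {v : W} (hv : v ∉ M)
    (hδv : Fintype.card W * x v ≤ δ * Fintype.card W + G.degree v) :
    8 * Fintype.card V * x v ≤ 1 := by
  classical
  have := hF.1.nonempty
  have hdeg : G.degree v ≤
      #{u ∈ commonNeighborFinset G M | G.Adj v u} + #(commonNeighborFinset G M)ᶜ := by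
    refine (card_le_card fun u hu => ?_).trans (card_union_le _ _)
    rw [G.mem_neighborFinset] at hu
    by_cases huC : u ∈ commonNeighborFinset G M <;> simp [huC, hu]
  have hadj := (card_adj_commonNeighborFinset_lt hF hG hAB hAM hv).le
  have hcompl := card_compl_commonNeighborFinset_le hM
  rify at hdeg hadj hMV
  set n : ℝ := (Fintype.card W : ℝ)
  set l : ℝ := (Fintype.card V : ℝ)
  have hl : 1 ≤ l := Nat.one_le_cast.mpr Fintype.card_pos
  have hn0 : 0 < n := by nlinarith
  have hdeg' : G.degree v ≤ l + l * (2 * δ * n) := by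
    have : #M * (2 * δ * n) ≤ l * (2 * δ * n) := by gcongr
    linarith
  have hl2 : l * (δ * n) ≤ l ^ 2 * δ * n := by
    rw [mul_assoc]
    gcongr
    exact le_self_pow₀ hl two_ne_zero
  refine le_of_mul_le_mul_right ?_ hn0
  calc 8 * l * x v * n = 8 * l * (n * x v) := by ring
    _ ≤ 8 * l * (δ * n + (l + l * (2 * δ * n))) := by gcongr; linarith
    _ = 8 * (l * (δ * n)) + 8 * l ^ 2 + 16 * (l ^ 2 * δ * n) := by ring
    _ ≤ 24 * (l ^ 2 * δ * n) + 8 * l ^ 2 := by linarith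
    _ ≤ 1 * n := by linarith [mul_le_mul_of_nonneg_right hδ hn0.le]

theorem hasCompleteSplit_of_le_card_heavyVertices {k : ℕ} (hF : F.IsTree) (hG : F.Free G)
    (hAB : F.IsBipartiteWith (A : Set V) B) (hAk : #A ≤ k + 1) (hkV : k < Fintype.card V)
    (hmax : ∀ G' : SimpleGraph W, F.Free G' → rho G' ≤ rho G) (hx : IsPerronVector G x)
    (hδ0 : 0 ≤ δ) (hδ : 32 * (Fintype.card V : ℝ) ^ 2 * δ ≤ 1)
    (hn : 32 * (Fintype.card V : ℝ) ^ 2 ≤ Fintype.card W)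
    (hdeg : ∀ v, Fintype.card W * x v ≤ δ * Fintype.card W + G.degree v)
    (hk : k ≤ #(heavyVertices x (1 - δ))) : HasCompleteSplit k G := by
  have := hF.1.nonempty
  have hl : (1 : ℝ) ≤ Fintype.card V := Nat.one_le_cast.mpr Fintype.card_pos
  have hlδ : Fintype.card V * δ ≤ 1 / 32 := by
    have := mul_le_mul_of_nonneg_right (le_self_pow₀ hl two_ne_zero) hδ0
    linarith
  have hln : 32 * (Fintype.card V : ℝ) ≤ Fintype.card W := by
    linarith [le_self_pow₀ hl two_ne_zero]
  set M := heavyVertices x (1 - δ)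
  have hMdeg (w : W) (hw : w ∈ M) : (1 - 2 * δ) * Fintype.card W ≤ G.degree w := by
    have := mul_le_mul_of_nonneg_left (mem_heavyVertices.mp hw)
      (Nat.cast_nonneg (α := ℝ) (Fintype.card W))
    linarith [hdeg w]
  have hcommon {T : Finset W} (hTM : T ⊆ M) (hT : #T ≤ Fintype.card V) :
      Fintype.card V < #(commonNeighborFinset G T) := by
    have hTδ : #T * δ ≤ Fintype.card V * δ := by gcongr
    have := half_card_le_card_commonNeighborFinset (T := T) (fun w hw => hMdeg w (hTM hw))
      (by linarith)
    rify
    linarith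
  have hMk : #M = k := by
    refine (hk.antisymm ?_).symm
    by_contra! hlt
    obtain ⟨T, hTM, hT⟩ := exists_subset_card_eq (Nat.succ_le_of_lt hlt)
    exact (hcommon hTM (by omega)).not_gt
      (card_commonNeighborFinset_lt hF hG hAB (card_pos.mp (by omega)) (by omega))
  have hAM : #A ≤ #M + 1 := by omega
  refine ⟨M, hMk, isCompleteBetween_of_forall_rho_le hF hG hAB hmax hx hAM
    (hcommon subset_rfl (by omega)) (fun m hm => ?_)
    fun v hv => mul_le_one_of_notMem hF hG hAB hAM (by omega) hδ0 hδ hn hMdeg hv (hdeg v)⟩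
  have hδ1 : δ ≤ Fintype.card V * δ := le_mul_of_one_le_left hδ0 hl
  linarith [mem_heavyVertices.mp hm]

end

theorem hasCompleteSplit_of_le_rho {k : ℕ} {δ η : ℝ} (hF : F.IsTree) (hG : F.Free G)
    (hAB : F.IsBipartiteWith (A : Set V) B) (hk : 1 ≤ k) (hAk : #A ≤ k + 1)
    (hkV : k < Fintype.card V) (hmax : ∀ G' : SimpleGraph W, F.Free G' → rho G' ≤ rho G)
    (hδ0 : 0 < δ) (hδ : 32 * (Fintype.card V : ℝ) ^ 2 * δ ≤ 1) (hη0 : 0 < η)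
    (hη : 24 * Fintype.card V * η ≤ δ ^ 2)
    (hn : 32 * (Fintype.card V : ℝ) ^ 2 ≤ Fintype.card W)
    (hρ : 2 * (Fintype.card V : ℝ) ≤ η ^ 2 * rho G)
    (hρ2 : (k - η) * Fintype.card W ≤ rho G ^ 2) : HasCompleteSplit k G := by
  classical
  have := hF.1.nonempty
  have hl : (1 : ℝ) ≤ Fintype.card V := Nat.one_le_cast.mpr Fintype.card_pos
  have hn0 : (0 : ℝ) < Fintype.card W := by nlinarith
  have : Nonempty W := Fintype.card_pos_iff.mp (by exact_mod_cast hn0)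
  have hδ1 : δ ≤ 1 / 32 := by
    linarith [mul_le_mul_of_nonneg_right (one_le_pow₀ (n := 2) hl) hδ0.le]
  have hηδ : 24 * Fintype.card V * η ≤ δ := by nlinarith
  obtain ⟨x, hx⟩ := exists_isPerronVector G
  obtain ⟨v, hv⟩ := hx.exists_eq_one
  have hdeg : (G.degree v : ℝ) ≤ Fintype.card W := Nat.cast_le.mpr (card_le_univ _)
  have hlow := rho_sq_mul_le_add_sum_codegree hF hG hx hη0 hρ v
  have hup := sum_codegree_heavyVertices_le hF hG hAB hAk hx hη0 hρ v
  rw [hv, mul_one] at hlow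
  have hηn : 0 ≤ η * Fintype.card W := by positivity
  have hlηn : η * Fintype.card W ≤ Fintype.card V * (η * Fintype.card W) :=
    le_mul_of_one_le_left hηn hl
  refine hasCompleteSplit_of_le_card_heavyVertices hF hG hAB hAk hkV hmax hx hδ0.le hδ hn
    (fun w => (card_mul_le_add_degree hF hG hAB hk hAk hx hη0 hρ hρ2 w).trans ?_)
    (le_card_heavyVertices (ε := 6 * Fintype.card V * η)
      (c := fun w => codegreeOutside G (heavyVertices x η) v w) hx.le_one hn0 hδ0 (by nlinarith)
      (fun w => Nat.cast_nonneg _) (fun w => Nat.cast_le.mpr (card_le_univ _)) (by linarith)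
      (hup.trans ?_))
  · gcongr
    linarith
  · linarith [mul_le_mul_of_nonneg_left hdeg (Nat.cast_nonneg (α := ℝ) k)]

theorem exists_hasCompleteSplit {k l : ℕ} (hk : 1 ≤ k) (hkl : k < l) :
    ∃ N : ℕ, ∀ (V : Type*) [Fintype V] (F : SimpleGraph V) (A B : Finset V) (W : Type*)
      [Fintype W] (G : SimpleGraph W), F.IsTree → Fintype.card V = l →
      F.IsBipartiteWith (A : Set V) B → #A ≤ k + 1 → N ≤ Fintype.card W → F.Free G →
      (∀ G' : SimpleGraph W, F.Free G' → rho G' ≤ rho G) →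
      √(k * (Fintype.card W - k)) ≤ rho G → HasCompleteSplit k G := by
  have hl : (1 : ℝ) ≤ l := Nat.one_le_cast.mpr (hk.trans hkl.le)
  have hk1 : (1 : ℝ) ≤ k := Nat.one_le_cast.mpr hk
  let δ : ℝ := 1 / (32 * l ^ 2)
  let η : ℝ := δ ^ 2 / (24 * l)
  have hδ0 : 0 < δ := by positivity
  have hδ : 32 * (l : ℝ) ^ 2 * δ = 1 := mul_one_div_cancel (by positivity)
  have hη0 : 0 < η := by positivity
  have hη : 24 * l * η = δ ^ 2 := mul_div_cancel₀ _ (by positivity)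
  have hη1 : η ≤ 1 / 2 := by
    have : δ ≤ 1 := by nlinarith
    nlinarith
  obtain ⟨N, hN⟩ := exists_nat_ge (32 * (l : ℝ) ^ 2 + (k ^ 2 / η + 2 * (2 * l / η ^ 2) ^ 2))
  refine ⟨N, fun V _ F A B W _ G hF hV hAB hA hW hG hmax hρ => ?_⟩
  classical
  subst hV
  have hNW : (N : ℝ) ≤ Fintype.card W := Nat.cast_le.mpr hW
  have hl2 : 0 ≤ 32 * (Fintype.card V : ℝ) ^ 2 := by positivity
  have hkη : 0 ≤ k ^ 2 / η := by positivity
  have hlη : 0 ≤ 2 * (2 * Fintype.card V / η ^ 2) ^ 2 := by positivity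
  obtain ⟨hρ0, hρk⟩ := Real.sqrt_le_iff.mp hρ
  have hρ2 : (k - η) * Fintype.card W ≤ rho G ^ 2 := by
    have : (k : ℝ) ^ 2 ≤ Fintype.card W * η := (div_le_iff₀ hη0).mp (by linarith)
    linarith
  have hρη : (2 * Fintype.card V / η ^ 2) ^ 2 ≤ rho G ^ 2 := by
    have : 1 / 2 * (Fintype.card W : ℝ) ≤ (k - η) * Fintype.card W := by gcongr; linarith
    linarith
  refine hasCompleteSplit_of_le_rho hF hG hAB hk hA hkl hmax hδ0 hδ.le hη0 hη.le (by linarith)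
    ?_ hρ2
  rw [mul_comm (η ^ 2)]
  exact (div_le_iff₀ (by positivity)).mp (abs_le_of_sq_le_sq' hρη hρ0).2

end Structure

section SplitEmbedding

variable {V W : Type*} {F : SimpleGraph V} {G : SimpleGraph W}

lemma exists_injOn_extend {s t : Finset V} {u : Finset W} {g : V → W} (hst : s ⊆ t)
    (htu : #t ≤ #u) (hg : Set.InjOn g s) (hgu : Set.MapsTo g s u) :
    ∃ f : V → W, Set.InjOn f t ∧ Set.MapsTo f t u ∧ Set.EqOn f g s := by
  classical
  obtain ⟨u', hsu', hu'u, hu'⟩ := exists_subsuperset_card_eq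
    (image_subset_iff.mpr fun v hv => hgu (mem_coe.mpr hv))
    ((card_image_of_injOn hg).trans_le (card_le_card hst)) htu
  obtain ⟨e, he⟩ := Set.MapsTo.exists_equiv_extend_of_card_eq (α := t) (t := u')
    (s := {v | v.1 ∈ s}) (f := fun v => g v) (by simpa using hu'.symm)
    (fun v hv => hsu' (mem_image_of_mem g hv))
    (fun v hv w hw hvw => Subtype.ext (hg hv hw hvw))
  let f (v : V) : W := if hv : v ∈ t then e ⟨v, hv⟩ else g v
  have hf (v : V) (hv : v ∈ t) : f v = e ⟨v, hv⟩ := dif_pos hv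
  refine ⟨f, fun v hv w hw hvw => ?_, fun v hv => ?_, fun v hv => ?_⟩
  · rw [hf v hv, hf w hw] at hvw
    exact congrArg Subtype.val (e.injective (Subtype.ext hvw))
  · rw [hf v hv]
    exact hu'u (e _).2
  · rw [hf v (hst hv)]
    exact he _ hv

lemma isContained_of_isCompleteBetween [Fintype V] [Fintype W] {L : Finset W} {C D : Finset V}
    {g : V → W} (hL : G.IsCompleteBetween (L : Set W) (L : Set W)ᶜ) (hCL : #C ≤ #L)
    (hC : F.IsIndepSet C ∨ G.IsClique L) (hCD : Disjoint C D) (hgi : Set.InjOn g D)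
    (hgL : Set.MapsTo g D (L : Set W)ᶜ)
    (hD : ∀ ⦃u v⦄, u ∉ C → v ∉ C → F.Adj u v → u ∈ D ∧ v ∈ D ∧ G.Adj (g u) (g v))
    (hcard : Fintype.card V + #L ≤ Fintype.card W) : F.IsContained G := by
  classical
  rcases isEmpty_or_nonempty W with hW | hW
  · have : IsEmpty V := g.isEmpty
    exact ⟨⟨⟨isEmptyElim, fun {v} => isEmptyElim v⟩, fun v => isEmptyElim v⟩⟩
  obtain ⟨f₁, hf₁, hf₁L, -⟩ := exists_injOn_extend (s := ∅) (empty_subset C) hCL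
    (g := fun _ => Classical.arbitrary W) (by simp) (by simp [Set.MapsTo])
  obtain ⟨f₂, hf₂, hf₂L, hf₂g⟩ := exists_injOn_extend (t := Cᶜ) (u := Lᶜ)
    (subset_compl_iff_disjoint_left.mpr hCD) (by rw [card_compl, card_compl]; omega) hgi
    (by simpa using hgL)
  rw [coe_compl] at hf₂
  rw [coe_compl, coe_compl] at hf₂L
  set f : V → W := (C : Set V).piecewise f₁ f₂
  have hfL {v : V} (hv : v ∈ C) : f v ∈ L := by
    simpa [f, hv] using hf₁L (mem_coe.mpr hv)
  have hfLc {v : V} (hv : v ∉ C) : f v ∉ L := by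
    simpa [f, hv] using hf₂L (Set.mem_compl (mt mem_coe.mp hv))
  have hinj : f.Injective := (Set.injective_piecewise_iff _).mpr
    ⟨hf₁, hf₂, fun v hv w hw h => hf₂L hw (h ▸ hf₁L hv)⟩
  refine ⟨⟨⟨f, fun {u v} huv => ?_⟩, hinj⟩⟩
  by_cases hu : u ∈ C <;> by_cases hv : v ∈ C
  · rcases hC with hC | hC
    · exact absurd huv (hC hu hv huv.ne)
    · exact hC (hfL hu) (hfL hv) (hinj.ne huv.ne)
  · exact hL (hfL hu) (hfLc hv)
  · exact (hL (hfL hv) (hfLc hu)).symm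
  · obtain ⟨huD, hvD, hadj⟩ := hD hu hv huv
    have hfg {w : V} (hw : w ∉ C) (hwD : w ∈ D) : f w = g w := by
      simpa [f, hw] using hf₂g hwD
    rwa [hfg hu huD, hfg hv hvD]

lemma isIndepSet_of_isBipartiteWith {s t : Set V} (h : F.IsBipartiteWith s t) :
    F.IsIndepSet s :=
  fun _ hu _ hv _ huv => Set.disjoint_left.mp h.disjoint hv (h.mem_of_mem_adj hu huv)

variable [Fintype V] [Fintype W] {A B : Finset V} {L : Finset W}

lemma isContained_of_star (hAB : F.IsBipartiteWith (A : Set V) B)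
    (hL : G.IsCompleteBetween (L : Set W) (L : Set W)ᶜ) (hAL : #A ≤ #L + 1)
    (hcard : Fintype.card V + #L ≤ Fintype.card W) {x : V} (hx : x ∈ A) {a : W} (ha : a ∉ L)
    {T : Finset W} (hT : ∀ t ∈ T, t ∉ L ∧ G.Adj a t) [Fintype (F.neighborSet x)]
    (hxT : F.degree x ≤ #T) : F.IsContained G := by
  classical
  obtain ⟨h, hh, hhT, -⟩ := exists_injOn_extend (s := ∅) (empty_subset (F.neighborFinset x)) hxT
    (g := fun _ => a) (by simp) (by simp [Set.MapsTo])
  have hmaps {y : V} (hy : F.Adj x y) : h y ∉ L ∧ G.Adj a (h y) := hT _ (hhT (by simpa using hy))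
  have hxN : ∀ y ∈ F.neighborFinset x, y ≠ x := by
    rintro _ hy rfl
    simp at hy
  set g : V → W := Function.update h x a
  have hgx : g x = a := Function.update_self ..
  have hgN {y : V} (hy : F.Adj x y) : g y = h y := Function.update_of_ne hy.ne' ..
  have hstar {u v : V} (hu : u ∈ A) (huC : u ∉ A.erase x) (huv : F.Adj u v) :
      u = x ∧ F.Adj x v ∧ G.Adj (g u) (g v) := by
    obtain rfl : u = x := by_contra fun hux => huC (mem_erase.mpr ⟨hux, hu⟩)
    exact ⟨rfl, huv, by rw [hgx, hgN huv]; exact (hmaps huv).2⟩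
  refine isContained_of_isCompleteBetween (C := A.erase x) (D := insert x (F.neighborFinset x))
    (g := g) hL (by rw [card_erase_of_mem hx]; omega)
    (.inl ((isIndepSet_of_isBipartiteWith hAB).mono (by simp))) ?_ ?_ ?_ ?_ hcard
  · rw [disjoint_insert_right]
    refine ⟨notMem_erase x A, (disjoint_left.mpr fun y hy hyx => ?_)⟩
    rw [F.mem_neighborFinset] at hyx
    exact Set.disjoint_left.mp hAB.disjoint (mem_of_mem_erase hy) (hAB.mem_of_mem_adj hx hyx)
  · rw [coe_insert, Set.injOn_insert (by simp)]
    refine ⟨fun y hy z hz hyz => hh hy hz ?_, ?_⟩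
    · rwa [hgN (by simpa using hy), hgN (by simpa using hz)] at hyz
    · rintro ⟨y, hy, hyx⟩
      have hxy : F.Adj x y := by simpa using hy
      rw [hgx, hgN hxy] at hyx
      exact (hmaps hxy).2.ne' hyx
  · intro y hy
    rcases mem_insert.mp (mem_coe.mp hy) with rfl | hy
    · rwa [hgx]
    · have hxy : F.Adj x y := by simpa using hy
      rw [hgN hxy]
      exact (hmaps hxy).1
  · intro u v hu hv huv
    rcases hAB.mem_of_adj huv with ⟨huA, -⟩ | ⟨-, hvA⟩
    · obtain ⟨rfl, hxv, hadj⟩ := hstar huA hu huv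
      exact ⟨by simp, by simpa using .inr hxv, hadj⟩
    · obtain ⟨rfl, hxu, hadj⟩ := hstar hvA hv huv.symm
      exact ⟨by simpa using .inr hxu, by simp, hadj.symm⟩

lemma exists_injOn_pair_union_pair {α β : Type*} {x y x' y' : α} {a b a' b' : β} (hxy : x ≠ y)
    (hxy' : x' ≠ y') (hdisj : Disjoint ({x, y} : Set α) {x', y'}) (hab : a ≠ b) (hab' : a' ≠ b')
    (hdisj' : Disjoint ({a, b} : Set β) {a', b'}) :
    ∃ g : α → β, g x = a ∧ g y = b ∧ g x' = a' ∧ g y' = b' ∧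
      Set.InjOn g ({x, y} ∪ {x', y'}) := by
  classical
  simp only [Set.disjoint_insert_left, Set.disjoint_singleton_left, Set.mem_insert_iff,
    Set.mem_singleton_iff, not_or] at hdisj hdisj'
  refine ⟨fun v => if v = x then a else if v = y then b else if v = x' then a' else b',
    by grind, by grind, by grind, by grind, fun u hu v hv huv => ?_⟩
  simp only [Set.mem_union, Set.mem_insert_iff, Set.mem_singleton_iff] at hu hv
  grind

lemma isContained_of_two_leaves (hAB : F.IsBipartiteWith (A : Set V) B)
    (hL : G.IsCompleteBetween (L : Set W) (L : Set W)ᶜ) (hBL : #B ≤ #L + 2)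
    (hcard : Fintype.card V + #L ≤ Fintype.card W) {x x' y y' : V} (hyB : y ∈ B) (hyB' : y' ∈ B)
    (hyy' : y ≠ y') (hxx' : x ≠ x') (hy : ∀ v, F.Adj y v ↔ v = x)
    (hy' : ∀ v, F.Adj y' v ↔ v = x') {a b a' b' : W} (ha : a ∉ L) (hb : b ∉ L) (ha' : a' ∉ L)
    (hb' : b' ∉ L) (hab : G.Adj a b) (hab' : G.Adj a' b')
    (hdisj : Disjoint ({a, b} : Set W) {a', b'}) : F.IsContained G := by
  classical
  have hxA : x ∈ A := hAB.symm.mem_of_mem_adj hyB ((hy x).mpr rfl)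
  have hxA' : x' ∈ A := hAB.symm.mem_of_mem_adj hyB' ((hy' x').mpr rfl)
  have hne {u v : V} (hu : u ∈ A) (hv : v ∈ B) : u ≠ v := by
    rintro rfl
    exact Set.disjoint_left.mp hAB.disjoint hu hv
  have hxy := hne hxA hyB
  have hxy' := hne hxA' hyB'
  have hpairs : Disjoint ({x, y} : Set V) {x', y'} := by
    simp only [Set.disjoint_insert_left, Set.disjoint_singleton_left, Set.mem_insert_iff,
      Set.mem_singleton_iff, not_or]
    exact ⟨⟨hxx', hne hxA hyB'⟩, (hne hxA' hyB).symm, hyy'⟩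
  obtain ⟨g, hgx, hgy, hgx', hgy', hgi⟩ :=
    exists_injOn_pair_union_pair hxy hxy' hpairs hab.ne hab'.ne hdisj
  have hleaf {u v : V} (hu : u ∈ B) (huC : u ∉ (B.erase y).erase y') (huv : F.Adj u v) :
      u = y ∧ v = x ∨ u = y' ∧ v = x' := by
    obtain rfl | rfl : u = y ∨ u = y' := by
      by_contra! h
      exact huC (mem_erase.mpr ⟨h.2, mem_erase.mpr ⟨h.1, hu⟩⟩)
    · exact .inl ⟨rfl, (hy v).mp huv⟩
    · exact .inr ⟨rfl, (hy' v).mp huv⟩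
  have hsub : (B.erase y).erase y' ⊆ B := (erase_subset _ _).trans (erase_subset _ _)
  refine isContained_of_isCompleteBetween (C := (B.erase y).erase y') (D := {x, y} ∪ {x', y'})
    (g := g) hL ?_ (.inl ((isIndepSet_of_isBipartiteWith hAB.symm).mono (coe_subset.mpr hsub)))
    ?_ (by simpa only [coe_union, coe_insert, coe_singleton] using hgi) ?_ ?_ hcard
  · rw [card_erase_of_mem (mem_erase.mpr ⟨hyy'.symm, hyB'⟩), card_erase_of_mem hyB]
    omega
  · rw [disjoint_left]
    intro v hv hvD
    have hvB := hsub hv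
    grind
  · intro v hv
    simp only [coe_union, coe_insert, coe_singleton, Set.mem_union, Set.mem_insert_iff,
      Set.mem_singleton_iff] at hv
    rcases hv with (rfl | rfl) | rfl | rfl
    · rwa [hgx]
    · rwa [hgy]
    · rwa [hgx']
    · rwa [hgy']
  · intro u v hu hv huv
    rcases hAB.mem_of_adj huv with ⟨-, hvB⟩ | ⟨huB, -⟩
    · rcases hleaf hvB hv huv.symm with ⟨rfl, rfl⟩ | ⟨rfl, rfl⟩
      · simpa [hgx, hgy]
      · simpa [hgx', hgy']
    · rcases hleaf huB hu huv with ⟨rfl, rfl⟩ | ⟨rfl, rfl⟩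
      · simpa [hgx, hgy] using hab.symm
      · simpa [hgx', hgy'] using hab'.symm

end SplitEmbedding

section TargetGraph

variable {n k p : ℕ}

/-- The vertices of the complete subgraph `K_k` in `S n k p`. -/
def cliquePart (n k : ℕ) : Finset (Fin n) := {i | i.val < k}

@[simp]
lemma mem_cliquePart {i : Fin n} : i ∈ cliquePart n k ↔ i.val < k := by simp [cliquePart]

lemma card_cliquePart (hkn : k ≤ n) : #(cliquePart n k) = k := by
  rw [cliquePart, Fin.card_filter_val_lt, min_eq_right hkn]

lemma S_adj {i j : Fin n} : (S n k p).Adj i j ↔ i ≠ j ∧ (i.val < k ∨ j.val < k ∨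
    ∃ t < p, i.val = k + 2 * t ∧ j.val = k + 2 * t + 1 ∨
      j.val = k + 2 * t ∧ i.val = k + 2 * t + 1) := by
  simp only [S, SimpleGraph.fromRel_adj, and_or_left, exists_or, or_assoc, or_left_comm]

lemma S_adj_of_lt {i j : Fin n} (hi : i.val < k) (hij : i ≠ j) : (S n k p).Adj i j :=
  S_adj.mpr ⟨hij, .inl hi⟩

lemma S_mono {q : ℕ} (hpq : p ≤ q) : S n k p ≤ S n k q := by
  intro i j hij
  obtain ⟨hne, hi | hj | ⟨t, ht, h⟩⟩ := S_adj.mp hij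
  · exact S_adj_of_lt hi hne
  · exact (S_adj_of_lt hj hne.symm).symm
  · exact S_adj.mpr ⟨hne, .inr (.inr ⟨t, ht.trans_le hpq, h⟩)⟩

lemma isCompleteBetween_cliquePart :
    (S n k p).IsCompleteBetween (cliquePart n k : Set (Fin n)) (cliquePart n k : Set (Fin n))ᶜ :=
  fun _ hi _ hj => S_adj_of_lt (mem_cliquePart.mp hi) (ne_of_mem_of_not_mem hi hj)

lemma isClique_cliquePart : (S n k p).IsClique (cliquePart n k) :=
  fun _ hi _ _ hij => S_adj_of_lt (mem_cliquePart.mp hi) hij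

lemma isVertexCover_S_zero : (S n k 0).IsVertexCover (cliquePart n k) := by
  intro i j hij
  simpa using (S_adj.mp hij).2

lemma isVertexCover_S_one {c : Fin n} (hc : c.val = k ∨ c.val = k + 1) :
    (S n k 1).IsVertexCover (insert c (cliquePart n k) : Finset (Fin n)) := by
  intro i j hij
  have h := (S_adj.mp hij).2
  simp only [Nat.lt_one_iff, exists_eq_left, mul_zero, add_zero] at h
  simp only [coe_insert, Set.mem_insert_iff, mem_coe, mem_cliquePart, Fin.ext_iff]
  omega

lemma not_isVertexCover_S_one (hkn : k + 1 < n) : ¬ (S n k 1).IsVertexCover (cliquePart n k) := by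
  intro h
  have hadj : (S n k 1).Adj ⟨k, by omega⟩ ⟨k + 1, hkn⟩ :=
    S_adj.mpr ⟨by simp, .inr (.inr ⟨0, one_pos, .inl ⟨rfl, rfl⟩⟩)⟩
  simpa using h hadj

lemma S_connected (hk : 1 ≤ k) (hn : 0 < n) : (S n k p).Connected := by
  refine (SimpleGraph.connected_iff_exists_forall_reachable _).mpr ⟨⟨0, hn⟩, fun i => ?_⟩
  rcases eq_or_ne ⟨0, hn⟩ i with rfl | hi
  · exact .refl _
  · exact (S_adj_of_lt (Nat.zero_lt_of_lt hk) hi).reachable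

lemma sqrt_le_rho_S (hk : 1 ≤ k) (hkn : k < n) : √(k * (n - k) : ℝ) ≤ rho (S n k p) := by
  have hcard := card_cliquePart hkn.le
  have hcard' : #(cliquePart n k)ᶜ = n - k := by rw [card_compl, Fintype.card_fin, hcard]
  have h := sqrt_card_mul_card_le_rho (G := S n k p) (L := cliquePart n k) (R := (cliquePart n k)ᶜ)
    (card_pos.mp (by omega)) (card_pos.mp (by omega))
    (by rw [coe_compl]; exact isCompleteBetween_cliquePart)
  rwa [hcard, hcard', Nat.cast_sub hkn.le] at h

lemma exists_perm_val_eq {M : Finset (Fin n)} (hM : #M = k) {m : ℕ} {w : Fin m → Fin n}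
    (hw : w.Injective) (hwM : ∀ t, w t ∉ M) :
    ∃ e : Equiv.Perm (Fin n), (∀ i ∈ M, (e i).val < k) ∧ ∀ t, (e (w t)).val = k + t := by
  have hinj : (Fin.append (M.orderEmbOfFin hM) w).Injective :=
    Fin.append_injective_iff.mpr ⟨(M.orderEmbOfFin hM).injective, hw, fun s t h =>
      hwM t (h ▸ M.orderEmbOfFin_mem hM s)⟩
  have hle : k + m ≤ n := by simpa using Fintype.card_le_of_injective _ hinj
  obtain ⟨e, he⟩ := Equiv.Perm.exists_extending_pair _ _ hinj (Fin.castLE_injective hle)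
  refine ⟨e, fun i hi => ?_, fun t => ?_⟩
  · obtain ⟨s, rfl⟩ : i ∈ Set.range (M.orderEmbOfFin hM) := by simpa using hi
    have h := congrArg Fin.val (he (Fin.castAdd m s))
    rw [Fin.append_left] at h
    simp [h]
  · have h := congrArg Fin.val (he (Fin.natAdd k t))
    rw [Fin.append_right] at h
    simp [h]

lemma isContained_S_zero {G : SimpleGraph (Fin n)} {M : Finset (Fin n)} (hM : #M = k)
    (h : G.IsVertexCover M) : G.IsContained (S n k 0) := by
  obtain ⟨e, heM, -⟩ := exists_perm_val_eq hM (w := ![]) (Function.injective_of_subsingleton _)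
    (fun t => t.elim0)
  refine ⟨⟨⟨e, fun {i j} hij => ?_⟩, e.injective⟩⟩
  refine S_adj.mpr ⟨e.injective.ne hij.ne, ?_⟩
  exact (h hij).imp (heM i) fun hj => .inl (heM j hj)

lemma isContained_S_one {G : SimpleGraph (Fin n)} {M : Finset (Fin n)} (hM : #M = k) {u v : Fin n}
    (hu : u ∉ M) (hv : v ∉ M) (huv : u ≠ v)
    (h : ∀ ⦃i j⦄, G.Adj i j → i ∉ M → j ∉ M → s(i, j) = s(u, v)) :
    G.IsContained (S n k 1) := by
  obtain ⟨e, heM, heuv⟩ := exists_perm_val_eq hM (w := ![u, v])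
    (by simpa [Function.Injective, Fin.forall_fin_two] using ⟨huv, huv.symm⟩)
    (by simpa [Fin.forall_fin_two] using ⟨hu, hv⟩)
  have heu : (e u).val = k := heuv 0
  have hev : (e v).val = k + 1 := heuv 1
  refine ⟨⟨⟨e, fun {i j} hij => ?_⟩, e.injective⟩⟩
  refine S_adj.mpr ⟨e.injective.ne hij.ne, ?_⟩
  by_cases hi : i ∈ M
  · exact .inl (heM i hi)
  by_cases hj : j ∈ M
  · exact .inr (.inl (heM j hj))
  rcases Sym2.eq_iff.mp (h hij hi hj) with ⟨rfl, rfl⟩ | ⟨rfl, rfl⟩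
  · exact .inr (.inr ⟨0, one_pos, .inl ⟨heu, hev⟩⟩)
  · exact .inr (.inr ⟨0, one_pos, .inr ⟨heu, hev⟩⟩)

end TargetGraph

section Extremal

variable {V : Type*} {F : SimpleGraph V} {n k p : ℕ}

lemma nonempty_iso_of_isContained_of_rho_le {W W' : Type*} [Fintype W] [Fintype W']
    {G : SimpleGraph W} {H : SimpleGraph W'} (hH : H.Connected)
    (hcard : Fintype.card W = Fintype.card W') (hGH : G.IsContained H) (hrho : rho H ≤ rho G) :
    Nonempty (G ≃g H) := by
  obtain ⟨f⟩ := hGH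
  set e : W ≃ W' :=
    .ofBijective f ((Fintype.bijective_iff_injective_and_card f).mpr ⟨f.injective, hcard⟩)
  have hle : G.map e.toEmbedding ≤ H :=
    (SimpleGraph.map_le_iff_le_comap _ _ _).mpr fun u v huv => f.toHom.map_adj huv
  have hiso : G ≃g G.map e.toEmbedding := SimpleGraph.Iso.map e G
  rcases hle.eq_or_lt with heq | hlt
  · exact ⟨heq ▸ hiso⟩
  · exact absurd (hrho.trans_eq (rho_congr hiso)) (rho_lt_rho_of_lt hH hlt).not_ge

lemma finite_setOf_rho : {r : ℝ | ∃ G : SimpleGraph (Fin n), F.Free G ∧ r = rho G}.Finite :=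
  (Set.finite_range rho).subset fun _ ⟨G, _, hr⟩ => ⟨G, hr.symm⟩

lemma rho_le_spex {G : SimpleGraph (Fin n)} (hG : F.Free G) : rho G ≤ spex n F :=
  le_csSup finite_setOf_rho.bddAbove ⟨G, hG, rfl⟩

lemma SPEX_nonempty {G : SimpleGraph (Fin n)} (hG : F.Free G) : (SPEX n F).Nonempty := by
  have hne : {r : ℝ | ∃ G : SimpleGraph (Fin n), F.Free G ∧ r = rho G}.Nonempty :=
    ⟨_, G, hG, rfl⟩
  obtain ⟨H, hH, hr⟩ := hne.csSup_mem finite_setOf_rho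
  exact ⟨H, hH, hr.symm⟩

lemma SPEX_eq_isoClass (hk : 1 ≤ k) (hn : 0 < n) (hS : F.Free (S n k p))
    (h : ∀ G ∈ SPEX n F, G.IsContained (S n k p)) : SPEX n F = isoClass (S n k p) := by
  have hiso (G : SimpleGraph (Fin n)) (hG : G ∈ SPEX n F) : Nonempty (G ≃g S n k p) :=
    nonempty_iso_of_isContained_of_rho_le (S_connected hk hn) rfl (h G hG)
      ((rho_le_spex hS).trans_eq hG.2.symm)
  refine Set.Subset.antisymm hiso fun G ⟨e⟩ => ⟨(SimpleGraph.free_congr_right e).mpr hS, ?_⟩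
  obtain ⟨H, hH⟩ := SPEX_nonempty hS
  obtain ⟨e'⟩ := hiso H hH
  rw [rho_congr e, ← rho_congr e', hH.2]

lemma free_S_of_SPEX_eq_isoClass (h : SPEX n F = isoClass (S n k p)) : F.Free (S n k p) := by
  have hS : S n k p ∈ SPEX n F := h ▸ ⟨SimpleGraph.Iso.refl⟩
  exact hS.1

end Extremal

section TreeCover

variable {V : Type*} {F : SimpleGraph V} {A C : Finset V} {B : Set V} {r a a' b : V}

lemma eq_penultimate_of_dist_eq_add_one (hF : F.IsTree) {p : F.Walk r b} (hp : p.IsPath)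
    (hab : F.Adj a b) (h : F.dist r b = F.dist r a + 1) : a = p.penultimate := by
  classical
  obtain ⟨q, hq, hql⟩ := hF.connected.exists_path_of_dist r a
  have hbq : b ∉ q.support := fun hb => by
    have := (F.dist_le (q.takeUntil b hb)).trans (q.length_takeUntil_le_length hb)
    omega
  exact hF.isAcyclic.eq_penultimate_of_adj_end hp hab.symm
    (hF.isAcyclic.mem_support_of_ne_mem_support_of_adj_of_isPath hp hq hab.symm hbq)

lemma eq_of_adj_of_dist_eq_add_one (hF : F.IsTree) (ha : F.Adj a b) (ha' : F.Adj a' b)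
    (h : F.dist r b = F.dist r a + 1) (h' : F.dist r b = F.dist r a' + 1) : a = a' := by
  obtain ⟨p, hp⟩ := hF.connected.exists_isPath r b
  rw [eq_penultimate_of_dist_eq_add_one hF hp ha h, eq_penultimate_of_dist_eq_add_one hF hp ha' h']

lemma exists_adj_dist_eq_add_one (hF : F.IsTree) (ha : (F.neighborSet a).Nontrivial) (r : V) :
    ∃ b, F.Adj a b ∧ F.dist r b = F.dist r a + 1 := by
  obtain ⟨b, hb, b', hb', hne⟩ := ha
  by_contra! hno
  exact hne (eq_of_adj_of_dist_eq_add_one hF hb.symm hb'.symm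
    ((hF.dist_eq_dist_add_one_of_adj r hb).resolve_right (hno b hb))
    ((hF.dist_eq_dist_add_one_of_adj r hb').resolve_right (hno b' hb')))

-- Rooting the tree at a vertex `r` of `C \ A`, send each vertex of `A \ C` to one of its children:
-- this is an injection into `C \ A` which misses `r`.
lemma subset_of_isVertexCover_of_card_le (hF : F.IsTree) (hAB : F.IsBipartiteWith (A : Set V) B)
    (hdeg : ∀ a ∈ A, (F.neighborSet a).Nontrivial) (hC : F.IsVertexCover C) (hcard : #C ≤ #A) :
    A ⊆ C := by
  classical
  by_contra hAC
  have hmem {a b : V} (ha : a ∈ A \ C) (hab : F.Adj a b) : b ∈ C \ A := by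
    obtain ⟨haA, haC⟩ := mem_sdiff.mp ha
    exact mem_sdiff.mpr ⟨(hC hab).resolve_left haC,
      fun hbA => hAB.disjoint.notMem_of_mem_left hbA (hAB.mem_of_mem_adj haA hab)⟩
  obtain ⟨a₀, ha₀⟩ := sdiff_nonempty.mpr hAC
  obtain ⟨r, hr⟩ := (hdeg a₀ (mem_sdiff.mp ha₀).1).nonempty
  have hchild (a : V) (ha : a ∈ A \ C) : ∃ b, F.Adj a b ∧ F.dist r b = F.dist r a + 1 :=
    exists_adj_dist_eq_add_one hF (hdeg a (mem_sdiff.mp ha).1) r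
  choose! child hadj hdist using hchild
  have hinj : Set.InjOn child (A \ C : Finset V) := fun a ha a' ha' h =>
    eq_of_adj_of_dist_eq_add_one hF (hadj a ha) (h ▸ hadj a' ha') (hdist a ha) (h ▸ hdist a' ha')
  have hmaps : Set.MapsTo child (A \ C : Finset V) ((C \ A).erase r : Finset V) := fun a ha =>
    mem_erase.mpr ⟨fun h => by simpa [h] using hdist a ha, hmem ha (hadj a ha)⟩
  have hle := card_le_card_of_injOn child hmaps hinj
  have hlt := card_erase_lt_of_mem (hmem ha₀ hr)
  exact absurd (card_sdiff_le_card_sdiff_iff.mpr hcard) (by omega)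

end TreeCover

section CoverNumber

variable {V : Type*} {F : SimpleGraph V} {n k : ℕ}

lemma isVertexCover_of_isBipartiteWith {s t : Set V} (h : F.IsBipartiteWith s t) :
    F.IsVertexCover s :=
  fun _ _ huv => (h.mem_of_adj huv).imp And.left And.right

lemma vertexCoverNum_le_card {C : Finset V} (hC : F.IsVertexCover C) :
    F.vertexCoverNum ≤ (#C : ℕ) :=
  hC.vertexCoverNum_le.trans_eq (Set.encard_coe_eq_coe_finsetCard C)

lemma free_S_zero (hkn : k ≤ n) (h : (k : ℕ∞) < F.vertexCoverNum) : F.Free (S n k 0) := by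
  intro hFS
  have hle := hFS.vertexCoverNum_le_vertexCoverNum.trans
    (vertexCoverNum_le_card isVertexCover_S_zero)
  rw [card_cliquePart hkn] at hle
  exact h.not_ge hle

-- In a copy of `F`, each of `cliquePart n k ∪ {k}` and `cliquePart n k ∪ {k + 1}` would pull back
-- to a vertex cover of size at most `#A`, hence would contain `A`; but their intersection is too
-- small for that.
lemma free_S_one {A : Finset V} {B : Set V} (hF : F.IsTree)
    (hAB : F.IsBipartiteWith (A : Set V) B) (hdeg : ∀ a ∈ A, (F.neighborSet a).Nontrivial)
    (hA : #A = k + 1) (hkn : k + 1 < n) : F.Free (S n k 1) := by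
  classical
  rintro ⟨f⟩
  have := Fintype.ofInjective f f.injective
  have hsub (c : Fin n) (hc : c.val = k ∨ c.val = k + 1) {a : V} (ha : a ∈ A) :
      f a ∈ insert c (cliquePart n k) := by
    set C : Finset V := {v | f v ∈ insert c (cliquePart n k)}
    have hC : F.IsVertexCover C := by
      simpa [C, Set.preimage] using (isVertexCover_S_one hc).preimage f.toHom
    have hcard : #C ≤ #A := calc
      #C ≤ #(insert c (cliquePart n k)) :=
        card_le_card_of_injOn f (by simp [C, Set.MapsTo]) f.injective.injOn
      _ ≤ k + 1 :=
        (card_insert_le _ _).trans_eq (by rw [card_cliquePart (by omega)])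
      _ = #A := hA.symm
    have haC := subset_of_isVertexCover_of_card_le hF hAB hdeg hC hcard ha
    exact (mem_filter_univ a).mp haC
  have hclique (a : V) (ha : a ∈ A) : f a ∈ cliquePart n k := by
    have h₀ := hsub ⟨k, by omega⟩ (.inl rfl) ha
    have h₁ := hsub ⟨k + 1, hkn⟩ (.inr rfl) ha
    simp only [mem_insert, Fin.ext_iff, mem_cliquePart] at h₀ h₁
    rw [mem_cliquePart]
    omega
  have hle := card_le_card_of_injOn f hclique f.injective.injOn
  rw [card_cliquePart (by omega)] at hle
  omega

variable [Fintype V]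

lemma lt_vertexCoverNum_of_free_S {p : ℕ} (hn : Fintype.card V + k ≤ n) (h : F.Free (S n k p)) :
    (k : ℕ∞) < F.vertexCoverNum := by
  classical
  by_contra! hle
  obtain ⟨s, hs, hc⟩ := F.vertexCoverNum_exists
  have hcard : #s.toFinset ≤ #(cliquePart n k) := by
    rw [card_cliquePart (by omega)]
    rw [← hs, Set.encard_eq_coe_toFinset_card] at hle
    exact_mod_cast hle
  refine h (isContained_of_isCompleteBetween (C := s.toFinset) (D := ∅)
    (g := fun v => Fin.castLE (by omega) (Fintype.equivFin V v)) isCompleteBetween_cliquePart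
    hcard (.inr isClique_cliquePart) (disjoint_empty_right _) (by simp) (by simp [Set.MapsTo])
    (fun u v hu hv huv => ?_) (by rwa [card_cliquePart (by omega), Fintype.card_fin]))
  rw [Set.mem_toFinset] at hu hv
  exact absurd (hc huv) (by tauto)

end CoverNumber

section TreeDegrees

variable {V : Type*} [Fintype V] {F : SimpleGraph V} {A B : Finset V}

lemma card_add_card_of_isBipartiteWith [Nontrivial V] (hF : F.Preconnected)
    (hAB : F.IsBipartiteWith (A : Set V) B) : #A + #B = Fintype.card V := by
  classical
  have hunion : (A ∪ B : Finset V) = univ := by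
    rw [← coe_eq_univ, ← Set.univ_subset_iff, ← hF.support_eq_univ, coe_union]
    exact SimpleGraph.isBipartiteWith_support_subset hAB
  rw [← card_union_of_disjoint (disjoint_coe.mp hAB.disjoint), hunion, card_univ]

lemma le_minDegreeOn_iff [DecidableRel F.Adj] {d : ℕ} (hA : A.Nonempty) :
    d ≤ minDegreeOn F A ↔ ∀ x ∈ A, d ≤ F.degree x := by
  have hdef : minDegreeOn F A = sInf {d | ∃ x ∈ A, d = F.degree x} := by
    unfold minDegreeOn
    congr!
  obtain ⟨a, ha⟩ := hA
  have hmem := Nat.sInf_mem (⟨_, a, ha, rfl⟩ : {d | ∃ x ∈ A, d = F.degree x}.Nonempty)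
  rw [← hdef] at hmem
  refine ⟨fun h x hx => (h.trans_eq hdef).trans (Nat.sInf_le ⟨x, hx, rfl⟩), fun h => ?_⟩
  obtain ⟨x, hx, hd⟩ := hmem
  exact (h x hx).trans_eq hd.symm

variable [DecidableRel F.Adj]

lemma degree_eq_two_of_two_le_degree (hF : F.IsTree) (hAB : F.IsBipartiteWith (A : Set V) B)
    (hV : Fintype.card V = 2 * #A + 1) (hdeg : ∀ x ∈ A, 2 ≤ F.degree x) :
    ∀ x ∈ A, F.degree x = 2 := by
  classical
  have hsum : ∑ _ ∈ A, 2 = ∑ x ∈ A, F.degree x := by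
    have hE := hF.card_edgeFinset
    rw [SimpleGraph.isBipartiteWith_sum_degrees_eq_card_edges hAB, sum_const, smul_eq_mul]
    omega
  exact fun x hx => ((sum_eq_sum_iff_of_le hdeg).mp hsum x hx).symm

lemma card_le_degree_add_one (hF : F.Preconnected) {a : V}
    (h : ∀ b, F.Adj a b → ∀ v, F.Adj b v → v = a) : Fintype.card V ≤ F.degree a + 1 := by
  classical
  rw [← F.card_neighborFinset_eq_degree, ← card_insert_of_notMem (F.notMem_neighborFinset_self a)]
  by_contra! hlt
  obtain ⟨v, -, hv⟩ := exists_mem_notMem_of_card_lt_card (hlt.trans_eq card_univ.symm)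
  obtain ⟨d, -, hd₁, hd₂⟩ := (hF a v).some.exists_boundary_dart
    (insert a (F.neighborFinset a) : Finset V) (by simp) hv
  simp only [mem_coe, mem_insert, SimpleGraph.mem_neighborFinset, not_or] at hd₁ hd₂
  rcases hd₁ with rfl | hd₁
  · exact hd₂.2 d.adj
  · exact hd₂.1 (h _ hd₁ _ d.adj)

-- Two leaves with a common neighbour of degree two would form a connected component with it.
lemma exists_leaves_of_degree_eq_two (hF : F.IsTree) (hV : 3 < Fintype.card V)
    (hAB : F.IsBipartiteWith (A : Set V) B) (hdeg : ∀ x ∈ A, F.degree x = 2) :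
    ∃ y ∈ B, ∃ y' ∈ B, ∃ x x', y ≠ y' ∧ x ≠ x' ∧
      (∀ v, F.Adj y v ↔ v = x) ∧ ∀ v, F.Adj y' v ↔ v = x' := by
  classical
  have : Nontrivial V := Fintype.one_lt_card_iff_nontrivial.mp (by omega)
  have hleaf {y : V} (hy : F.degree y = 1) : y ∈ B ∧ ∃ x ∈ A, ∀ v, F.Adj y v ↔ v = x := by
    obtain ⟨x, hx, hx'⟩ := SimpleGraph.degree_eq_one_iff_existsUnique_adj.mp hy
    have hyA : y ∉ A := fun h => by simp [hdeg y h] at hy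
    have hyx := (hAB.mem_of_adj hx).resolve_left fun h => hyA h.1
    exact ⟨hyx.1, x, hyx.2, fun v => ⟨hx' v, fun h => h ▸ hx⟩⟩
  obtain ⟨y, y', hne, hy, hy'⟩ := hF.exists_ne_and_degree_eq_one
  obtain ⟨hyB, x, hxA, hx⟩ := hleaf hy
  obtain ⟨hyB', x', -, hx'⟩ := hleaf hy'
  refine ⟨y, hyB, y', hyB', x, x', hne, ?_, hx, hx'⟩
  rintro rfl
  have hnbrs : {y, y'} = F.neighborFinset x := by
    refine eq_of_subset_of_card_le ?_ ?_
    · simp [insert_subset_iff, F.adj_comm x, hx, hx']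
    · rw [F.card_neighborFinset_eq_degree, hdeg x hxA, card_pair hne]
  have hle : Fintype.card V ≤ F.degree x + 1 := by
    refine card_le_degree_add_one hF.connected.preconnected fun b hb v hbv => ?_
    rw [← F.mem_neighborFinset, ← hnbrs, mem_insert, mem_singleton] at hb
    rcases hb with rfl | rfl
    · exact (hx v).mp hbv
    · exact (hx' v).mp hbv
  rw [hdeg x hxA] at hle
  omega

end TreeDegrees

section EdgesOutside

variable {V W : Type*} [Fintype V] [Fintype W] {F : SimpleGraph V} {G : SimpleGraph W}
  {A B : Finset V} {M : Finset W}

lemma isVertexCover_of_free_of_leaf (hG : F.Free G) (hAB : F.IsBipartiteWith (A : Set V) B)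
    (hM : G.IsCompleteBetween (M : Set W) (M : Set W)ᶜ) (hAM : #A ≤ #M + 1)
    (hcard : Fintype.card V + #M ≤ Fintype.card W) {x : V} (hx : x ∈ A)
    [Fintype (F.neighborSet x)] (hdeg : F.degree x = 1) : G.IsVertexCover M := by
  intro a b hab
  by_contra! hcon
  exact hG (isContained_of_star hAB hM hAM hcard hx (T := {b}) hcon.1 (by simpa using ⟨hcon.2, hab⟩)
    (by simp [hdeg]))

lemma eq_of_adj_of_free_of_degree_eq_two (hG : F.Free G) (hAB : F.IsBipartiteWith (A : Set V) B)
    (hM : G.IsCompleteBetween (M : Set W) (M : Set W)ᶜ) (hAM : #A ≤ #M + 1)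
    (hcard : Fintype.card V + #M ≤ Fintype.card W) {x : V} (hx : x ∈ A)
    [Fintype (F.neighborSet x)] (hdeg : F.degree x = 2) {a b c : W} (ha : a ∉ M) (hb : b ∉ M)
    (hc : c ∉ M) (hab : G.Adj a b) (hac : G.Adj a c) : b = c := by
  classical
  by_contra hbc
  exact hG (isContained_of_star hAB hM hAM hcard hx (T := {b, c}) ha
    (by simp [hb, hc, hab, hac]) (by simp [hdeg, hbc]))

lemma edge_eq_of_free (hF : F.IsTree) (hV : 3 < Fintype.card V)
    (hAB : F.IsBipartiteWith (A : Set V) B) [DecidableRel F.Adj] (hdeg : ∀ x ∈ A, F.degree x = 2)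
    (hG : F.Free G) (hM : G.IsCompleteBetween (M : Set W) (M : Set W)ᶜ) (hAM : #A ≤ #M + 1)
    (hBM : #B ≤ #M + 2) (hcard : Fintype.card V + #M ≤ Fintype.card W) {a b a' b' : W}
    (ha : a ∉ M) (hb : b ∉ M) (ha' : a' ∉ M) (hb' : b' ∉ M) (hab : G.Adj a b)
    (hab' : G.Adj a' b') : s(a, b) = s(a', b') := by
  obtain ⟨y, hy, y', hy', x, x', hyy', hxx', hyx, hyx'⟩ :=
    exists_leaves_of_degree_eq_two hF hV hAB hdeg
  have hxA : x ∈ A := hAB.symm.mem_of_mem_adj hy ((hyx x).mpr rfl)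
  have hcherry {u v w : W} (hu : u ∉ M) (hv : v ∉ M) (hw : w ∉ M) :
      G.Adj u v → G.Adj u w → v = w :=
    eq_of_adj_of_free_of_degree_eq_two hG hAB hM hAM hcard hxA (hdeg x hxA) hu hv hw
  have hmeet : ¬ Disjoint ({a, b} : Set W) {a', b'} := fun hdisj =>
    hG (isContained_of_two_leaves hAB hM hBM hcard hy hy' hyy' hxx' hyx hyx' ha hb ha' hb'
      hab hab' hdisj)
  obtain ⟨c, hc, hc'⟩ := Set.not_disjoint_iff.mp hmeet
  rcases hc with rfl | rfl <;> rcases hc' with rfl | rfl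
  · rw [hcherry ha hb hb' hab hab']
  · rw [hcherry ha hb ha' hab hab'.symm, Sym2.eq_swap]
  · rw [hcherry hb ha hb' hab.symm hab', Sym2.eq_swap]
  · rw [hcherry hb ha ha' hab.symm hab'.symm]

end EdgesOutside

section MainResult

variable {V : Type*} {F : SimpleGraph V} {A B : Finset V} {n k : ℕ}

lemma exists_isBipartiteWith_card_le [Finite V] (hF : F.IsBipartite) :
    ∃ A B : Finset V, F.IsBipartiteWith (A : Set V) B ∧ #A ≤ #B := by
  classical
  have := Fintype.ofFinite V
  obtain ⟨s, t, hst⟩ := hF.exists_isBipartiteWith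
  rcases le_total #s.toFinset #t.toFinset with hle | hle
  · exact ⟨s.toFinset, t.toFinset, by simpa using hst, hle⟩
  · exact ⟨t.toFinset, s.toFinset, by simpa using hst.symm, hle⟩

lemma exists_forall_mem_SPEX_hasCompleteSplit {k l : ℕ} (hk : 1 ≤ k) (hkl : k < l)
    (hl : l ≤ 2 * k + 3) :
    ∃ N : ℕ, ∀ n, N ≤ n → ∀ (V : Type*) [Fintype V] (F : SimpleGraph V) (p : ℕ),
      F.IsTree → Fintype.card V = l → F.Free (S n k p) → ∀ G ∈ SPEX n F, HasCompleteSplit k G := by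
  obtain ⟨N, hN⟩ := exists_hasCompleteSplit hk hkl
  refine ⟨max N (k + 1), fun n hn V _ F p hF hV hS G hG => ?_⟩
  have : Nontrivial V := Fintype.one_lt_card_iff_nontrivial.mp (by omega)
  obtain ⟨A, B, hAB, hle⟩ := exists_isBipartiteWith_card_le hF.isBipartite
  have hcard := card_add_card_of_isBipartiteWith hF.connected.preconnected hAB
  refine hN V F A B (Fin n) G hF hV hAB (by omega) ?_ hG.1 ?_ ?_
  · exact (le_max_left _ _).trans (hn.trans_eq (Fintype.card_fin n).symm)
  · exact fun G' hG' => (rho_le_spex hG').trans_eq hG.2.symm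
  · rw [Fintype.card_fin]
    exact (sqrt_le_rho_S hk ((le_max_right _ _).trans hn)).trans
      ((rho_le_spex hS).trans_eq hG.2.symm)

variable [Fintype V]

lemma SPEX_eq_isoClass_of_even (hF : F.IsTree) (hk : 1 ≤ k) (hV : Fintype.card V = 2 * k + 2)
    (hn : Fintype.card V + k ≤ n) (hβ : F.vertexCoverNum = (k + 1 : ℕ))
    (hsplit : F.Free (S n k 0) → ∀ G ∈ SPEX n F, HasCompleteSplit k G) :
    SPEX n F = isoClass (S n k 0) := by
  classical
  have : Nontrivial V := Fintype.one_lt_card_iff_nontrivial.mp (by omega)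
  have hS : F.Free (S n k 0) := free_S_zero (by omega) (by rw [hβ]; exact_mod_cast k.lt_succ_self)
  obtain ⟨A, B, hAB, hle⟩ := exists_isBipartiteWith_card_le hF.isBipartite
  have hsum := card_add_card_of_isBipartiteWith hF.connected.preconnected hAB
  have hA : k + 1 ≤ #A := by
    exact_mod_cast hβ ▸ vertexCoverNum_le_card (isVertexCover_of_isBipartiteWith hAB)
  obtain ⟨x, hx⟩ := hF.exists_vert_degree_one_of_nontrivial
  refine SPEX_eq_isoClass hk (by omega) hS fun G hG => ?_
  obtain ⟨M, hM, hMG⟩ := hsplit hS G hG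
  have hcard : Fintype.card V + #M ≤ Fintype.card (Fin n) := by rwa [hM, Fintype.card_fin]
  obtain ⟨z, hxz⟩ := hF.connected.preconnected.exists_adj_of_nontrivial x
  refine isContained_S_zero hM ?_
  rcases hAB.mem_of_adj hxz with ⟨hxA, -⟩ | ⟨hxB, -⟩
  · exact isVertexCover_of_free_of_leaf hG.1 hAB hMG (by omega) hcard hxA hx
  · exact isVertexCover_of_free_of_leaf hG.1 hAB.symm hMG (by omega) hcard hxB hx

lemma SPEX_eq_isoClass_of_odd [DecidableRel F.Adj] (hF : F.IsTree) (hk : 1 ≤ k)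
    (hV : Fintype.card V = 2 * k + 3) (hn : Fintype.card V + k ≤ n)
    (hAB : F.IsBipartiteWith (A : Set V) B) (hA : #A = k + 1) (hδ : ∀ x ∈ A, 2 ≤ F.degree x)
    (hsplit : F.Free (S n k 1) → ∀ G ∈ SPEX n F, HasCompleteSplit k G) :
    SPEX n F = isoClass (S n k 1) := by
  have : Nontrivial V := Fintype.one_lt_card_iff_nontrivial.mp (by omega)
  have hsum := card_add_card_of_isBipartiteWith hF.connected.preconnected hAB
  have hdeg := degree_eq_two_of_two_le_degree hF hAB (by omega) hδ
  have hS : F.Free (S n k 1) := by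
    refine free_S_one hF hAB (fun x hx => ?_) hA (by omega)
    rw [← F.coe_neighborFinset]
    exact one_lt_card_iff_nontrivial.mp (hδ x hx)
  refine SPEX_eq_isoClass hk (by omega) hS fun G hG => ?_
  obtain ⟨M, hM, hMG⟩ := hsplit hS G hG
  have hcard : Fintype.card V + #M ≤ Fintype.card (Fin n) := by rwa [hM, Fintype.card_fin]
  by_cases hcover : G.IsVertexCover M
  · exact (isContained_S_zero hM hcover).trans (.of_le (S_mono zero_le_one))
  obtain ⟨u, v, huv, hu, hv⟩ : ∃ u v, G.Adj u v ∧ u ∉ M ∧ v ∉ M := by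
    simpa [SimpleGraph.IsVertexCover] using hcover
  exact isContained_S_one hM hu hv huv.ne fun i j hij hi hj =>
    edge_eq_of_free hF (by omega) hAB hdeg hG.1 hMG (by omega) (by omega) hcard hi hj hu hv hij huv

lemma two_le_degree_of_free_S_one [Nontrivial V] [DecidableRel F.Adj] (hF : F.Preconnected)
    (hn : Fintype.card V + k ≤ n) (hAB : F.IsBipartiteWith (A : Set V) B) (hA : #A ≤ k + 1)
    (hS : F.Free (S n k 1)) {x : V} (hx : x ∈ A) : 2 ≤ F.degree x := by
  have hpos := hF.degree_pos_of_nontrivial x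
  have hV := Fintype.one_lt_card (α := V)
  by_contra! hlt
  refine not_isVertexCover_S_one (by omega) (isVertexCover_of_free_of_leaf hS hAB
    isCompleteBetween_cliquePart ?_ ?_ hx (by omega))
  · rwa [card_cliquePart (by omega)]
  · rwa [card_cliquePart (by omega), Fintype.card_fin]

theorem SPEX_eq_isoClass_iff_of_even (hF : F.IsTree) (hk : 1 ≤ k)
    (hV : Fintype.card V = 2 * k + 2) (hn : Fintype.card V + k ≤ n)
    (hsplit : F.Free (S n k 0) → ∀ G ∈ SPEX n F, HasCompleteSplit k G) :
    SPEX n F = isoClass (S n k 0) ↔ F.vertexCoverNum = (k + 1 : ℕ) := by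
  refine ⟨fun h => le_antisymm ?_ ?_, fun hβ => SPEX_eq_isoClass_of_even hF hk hV hn hβ hsplit⟩
  · have : Nontrivial V := Fintype.one_lt_card_iff_nontrivial.mp (by omega)
    obtain ⟨A, B, hAB, hle⟩ := exists_isBipartiteWith_card_le hF.isBipartite
    have hsum := card_add_card_of_isBipartiteWith hF.connected.preconnected hAB
    exact (vertexCoverNum_le_card (isVertexCover_of_isBipartiteWith hAB)).trans
      (Nat.cast_le.mpr (by omega))
  · exact Order.add_one_le_of_lt (lt_vertexCoverNum_of_free_S hn (free_S_of_SPEX_eq_isoClass h))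

theorem SPEX_eq_isoClass_iff_of_odd (hF : F.IsTree) (hk : 1 ≤ k)
    (hV : Fintype.card V = 2 * k + 3) (hn : Fintype.card V + k ≤ n)
    (hAB : F.IsBipartiteWith (A : Set V) B) (hle : #A ≤ #B)
    (hsplit : F.Free (S n k 1) → ∀ G ∈ SPEX n F, HasCompleteSplit k G) :
    SPEX n F = isoClass (S n k 1) ↔
      F.vertexCoverNum = (k + 1 : ℕ) ∧ 2 ≤ minDegreeOn F A := by
  classical
  have : Nontrivial V := Fintype.one_lt_card_iff_nontrivial.mp (by omega)
  have hsum := card_add_card_of_isBipartiteWith hF.connected.preconnected hAB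
  have hβA := vertexCoverNum_le_card (isVertexCover_of_isBipartiteWith hAB)
  have hne (h : (k + 1 : ℕ) ≤ F.vertexCoverNum) : #A = k + 1 :=
    le_antisymm (by omega) (by exact_mod_cast h.trans hβA)
  constructor
  · intro h
    have hS := free_S_of_SPEX_eq_isoClass h
    have hβ : (k + 1 : ℕ) ≤ F.vertexCoverNum :=
      Order.add_one_le_of_lt (lt_vertexCoverNum_of_free_S hn hS)
    have hA := hne hβ
    refine ⟨(hβA.trans_eq (by rw [hA])).antisymm hβ, ?_⟩
    exact (le_minDegreeOn_iff (card_pos.mp (by omega))).mpr fun x =>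
      two_le_degree_of_free_S_one hF.connected.preconnected hn hAB hA.le hS
  · rintro ⟨hβ, hδ⟩
    have hA := hne hβ.ge
    exact SPEX_eq_isoClass_of_odd hF hk hV hn hAB hA
      ((le_minDegreeOn_iff (card_pos.mp (by omega))).mp hδ) hsplit

end MainResult

end SpectralTuran

theorem theorem1p3 (ℓ : ℕ) (hℓ : 4 ≤ ℓ) :
    ∃ N : ℕ, ∀ n : ℕ, N ≤ n →
      ∀ (V : Type*) [Fintype V] (F : SimpleGraph V), F.IsTree → Fintype.card V = ℓ →
        (Even ℓ →
          (SpectralTuran.SPEX n F =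
              SpectralTuran.isoClass (SpectralTuran.S n ((ℓ - 2) / 2) 0) ↔
            F.vertexCoverNum = ((ℓ / 2 : ℕ) : ℕ∞))) ∧
        (Odd ℓ →
          ∀ A B : Finset V, F.IsBipartiteWith (A : Set V) (B : Set V) → A.card ≤ B.card →
            (SpectralTuran.SPEX n F =
                SpectralTuran.isoClass (SpectralTuran.S n ((ℓ - 3) / 2) 1) ↔
              F.vertexCoverNum = (((ℓ - 1) / 2 : ℕ) : ℕ∞) ∧
                2 ≤ SpectralTuran.minDegreeOn F A)) := by
  obtain ⟨k, hk⟩ : ∃ k, k = (ℓ - 2) / 2 := ⟨_, rfl⟩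
  obtain ⟨N, hN⟩ := SpectralTuran.exists_forall_mem_SPEX_hasCompleteSplit (k := k) (l := ℓ)
    (by omega) (by omega) (by omega)
  refine ⟨max N (ℓ + k), fun n hn V _ F hF hV => ⟨fun heven => ?_, fun hodd A B hAB hle => ?_⟩⟩
  · rw [← hk, show ℓ / 2 = k + 1 by omega]
    exact SpectralTuran.SPEX_eq_isoClass_iff_of_even hF (by omega) (by grind) (by omega)
      (hN n (by omega) V F 0 hF hV)
  · rw [show (ℓ - 3) / 2 = k by grind, show (ℓ - 1) / 2 = k + 1 by grind]
    exact SpectralTuran.SPEX_eq_isoClass_iff_of_odd hF (by omega) (by grind) (by omega) hAB hle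
      (hN n (by omega) V F 1 hF hV)
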